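/- **Corollary 3 (Delayed posterior sampling for linear bandits).** Consider a linear bandit with $T\ge 1$ rounds in dimension $d\ge 1$ and unknown parameter $\theta_*\in\mathbb{R}^d$, $\|\theta_*\|\le\sqrt d$. In round $t$ a non-empty decision set $D_t\subseteq\mathbb{R}^d$ is revealed, which may be random and may depend on the past, with $\|x\|\le 1$ for all $x\in D_t$; the learner plays $x_t\in D_t$, and this generates the reward $y_t=x_t^{\mathrm T}\theta_*+\eta_t$. The noise $\eta_t$ is mean-zero and $B$-sub-Gaussian conditionally on the past, on $x_t$ and on the delay $\tau_t$: $\mathbb{E}[e^{\gamma\eta_t}\mid\cdot\,]\le e^{B^2\gamma^2/2}$ for all $\gamma\in\mathbb{R}$. The delays $\tau_t\in\{0,1,2,\dots\}$ are i.i.d., each $\tau_t$ being independent of the past and of $x_t$, and $(v,b)$-sub-exponential: $v,b\ge 0$ and $\mathbb{E}[e^{\gamma(\tau-\mathbb{E}[\tau])}]\le e^{v^2\gamma^2/2}$ for $|\gamma|\le 1/b$. The reward of round $s$ can be used in round $t$ if and only if $s+\tau_s\le t-1$. Let $0<\delta<1$, and let $u$ be such that $x^{\mathrm T}\theta_*\le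 u$ for all $x\in\bigcup_t D_t$ ($u=1$ if mean rewards lie in $[0,1]$). Delayed-PSLB, with regularisation $\lambda=1$, variance $\sigma^2=1$ and scaling $\nu$, acts in round $t$ as follows. It computes $$\Omega_t=I+\sum_{s:\,s+\tau_s\le t-1}x_sx_s^{\mathrm T},\qquad \widehat w_t=\Omega_t^{-1}\sum_{s:\,s+\tau_s\le t-1}y_sx_s ,$$ draws $M=\lceil\log(4T/\delta)/\log(64/63)\rceil$ vectors $\widetilde w_t^{1},\dots,\widetilde w_t^{M}$, i.i.d. given the past, from $\mathcal N(\widehat w_t,\nu^2\Omega_t^{-1})$, and plays some $x_t\in\arg\max_{x\in D_t}\min\{\max_m x^{\mathrm T}\widetilde w_t^m,\,u\}$. Put $L=1+\log(dT/\delta)$ and let the scaling satisfy $C_{\delta/4}\le\nu\le\kappa\sqrt d\,L^p$, where $C_{\delta}=B\sqrt{d\log(1+T)+2\log(T/\delta)}+\sqrt d$ (so $\nu=C_{\delta/4}$ is allowed, with $p=1$ and $\kappa$ depending only on $B$). Then for every $p\in\mathbb{N}$ there is $q\in\mathbb{N}$, depending only on $p$, and for all $B,\kappa$ there are constants $c,c',c''>0$,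 depending only on $p,B,\kappa$ (in particular not on $d,T,\delta,v,b$, the delay law or the bandit), such that, with the polylogarithmic factor $\iota=L^q$, with probability at least $1-\delta$ the regret satisfies $$R(T)=\sum_{t=1}^{T}\Big(\sup_{x\in D_t}x^{\mathrm T}\theta_*-x_t^{\mathrm T}\theta_*\Big)\le c\sqrt{d^3T\iota}+c'\,d^2\,\mathbb{E}[\tau]\,\iota+c''\iota .$$ -/

import Mathlib

open MeasureTheory ProbabilityTheory
open scoped NNReal

noncomputable section

open scoped MatrixOrder Matrix.Norms.L2Operator

/-! ### Delays -/

/-- The expected delay of a delay distribution on `ℕ`. -/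
def meanDelay (f : PMF ℕ) : ℝ := ∫ n : ℕ, (n : ℝ) ∂f.toMeasure

/-- `f` is a `(v, b)`-sub-exponential distribution on the non-negative integers: with `τ ∼ f`,
`E exp (γ (τ - E τ)) ≤ exp (v² γ² / 2)` whenever `|γ| ≤ 1 / b` (every `γ` if `b = 0`). -/
def IsSubexponentialDelay (f : PMF ℕ) (v b : ℝ) : Prop :=
  0 ≤ v ∧ 0 ≤ b ∧ Integrable (fun n : ℕ => (n : ℝ)) f.toMeasure ∧
    ∀ γ : ℝ, |γ| * b ≤ 1 →
      Integrable (fun n : ℕ => Real.exp (γ * ((n : ℝ) - meanDelay f))) f.toMeasure ∧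
      ∫ n : ℕ, Real.exp (γ * ((n : ℝ) - meanDelay f)) ∂f.toMeasure
        ≤ Real.exp (v ^ 2 * γ ^ 2 / 2)

/-! ### Linear bandits with delayed feedback

Rounds are numbered `0, 1, …, T - 1`. In round `t` the decision set `D t` is revealed, the learner
plays `x t ∈ D t`, and the delay `τ t` and the noise `η t` are realised. The learner can use the
reward `⟪x t, θ⟫ + η t` from round `t + τ t + 1` on; so `τ t = 0` means that there is no delay. -/

/-- A run of `T` rounds of a `d`-dimensional linear bandit with conditionally `B`-sub-Gaussian
noise and i.i.d. delays with law `f`, under an arbitrary learner. The decision sets may be random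
and may depend on everything that has happened in earlier rounds. -/
structure DelayedLinearBandit (d T : ℕ) (B : ℝ≥0) (f : PMF ℕ)
    {Ω : Type*} [mΩ : MeasurableSpace Ω] [StandardBorelSpace Ω]
    (P : Measure Ω) [IsProbabilityMeasure P] where
  /-- the unknown parameter -/
  θ : EuclideanSpace ℝ (Fin d)
  /-- the decision sets -/
  D : ℕ → Ω → Set (EuclideanSpace ℝ (Fin d))
  /-- the actions played -/
  x : ℕ → Ω → EuclideanSpace ℝ (Fin d)
  /-- the delays -/
  τ : ℕ → Ω → ℕ
  /-- the noise -/
  η : ℕ → Ω → ℝ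
  /-- everything determined before the learner acts in round `t` (including `D t`) -/
  pre : Filtration ℕ mΩ
  /-- everything determined once the action of round `t` has been chosen -/
  act : Filtration ℕ mΩ
  /-- everything determined once, in addition, the delay of round `t` has been drawn -/
  del : Filtration ℕ mΩ
  pre_le_act : ∀ t, pre t ≤ act t
  act_le_del : ∀ t, act t ≤ del t
  del_le_pre : ∀ t, del t ≤ pre (t + 1)
  norm_θ_le : ‖θ‖ ≤ √(d : ℝ)
  norm_le_one : ∀ t < T, ∀ ω, ∀ a ∈ D t ω, ‖a‖ ≤ 1
  /-- `D t` is known before the learner acts: its support function is measurable -/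
  measurable_D : ∀ t < T, ∀ w : EuclideanSpace ℝ (Fin d),
    Measurable[pre t] fun ω => sSup ((fun a => inner ℝ a w) '' D t ω)
  x_mem : ∀ t < T, ∀ ω, x t ω ∈ D t ω
  measurable_x : ∀ t < T, Measurable[act t] (x t)
  measurable_τ : ∀ t < T, Measurable[del t] (τ t)
  law_τ : ∀ t < T, P.map (τ t) = f.toMeasure
  /-- the delay is drawn independently of the past and of the action -/
  indep_τ : ∀ t < T, Indep (MeasurableSpace.comap (τ t) ⊤) (act t) P
  measurable_η : ∀ t < T, Measurable[pre (t + 1)] (η t)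
  mean_η : ∀ t < T, P[η t | del t] =ᵐ[P] 0
  subgaussian_η : ∀ t < T, HasCondSubgaussianMGF (del t) (del.le t) (η t) (B ^ 2) P

namespace DelayedLinearBandit

variable {d T : ℕ} {B : ℝ≥0} {f : PMF ℕ} {Ω : Type*} [mΩ : MeasurableSpace Ω]
  [StandardBorelSpace Ω] {P : Measure Ω} [IsProbabilityMeasure P]

/-- The reward of round `t`. -/
def y (𝓑 : DelayedLinearBandit d T B f P) (t : ℕ) (ω : Ω) : ℝ :=
  inner ℝ (𝓑.x t ω) 𝓑.θ + 𝓑.η t ω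

/-- The regret accumulated over the `T` rounds. -/
def regret (𝓑 : DelayedLinearBandit d T B f P) (ω : Ω) : ℝ :=
  ∑ t ∈ Finset.range T,
    (sSup ((fun a => inner ℝ a 𝓑.θ) '' 𝓑.D t ω) - inner ℝ (𝓑.x t ω) 𝓑.θ)

/-- The rounds whose feedback is available at the beginning of round `t`. -/
def observed (𝓑 : DelayedLinearBandit d T B f P) (t : ℕ) (ω : Ω) : Finset ℕ :=
  {s ∈ Finset.range t | s + 𝓑.τ s ω < t}

/-- The posterior precision `σ⁻² ∑ xₛ xₛᵀ + lam I`, the sum being over the observed rounds `s`. -/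
def precision (𝓑 : DelayedLinearBandit d T B f P) (lam σ : ℝ) (t : ℕ) (ω : Ω) :
    Matrix (Fin d) (Fin d) ℝ :=
  (σ ^ 2)⁻¹ • ∑ s ∈ 𝓑.observed t ω, Matrix.vecMulVec (𝓑.x s ω).ofLp (𝓑.x s ω).ofLp
    + lam • (1 : Matrix (Fin d) (Fin d) ℝ)

/-- The posterior mean, i.e. the ridge estimate from the observed rounds. -/
def posteriorMean (𝓑 : DelayedLinearBandit d T B f P) (lam σ : ℝ) (t : ℕ) (ω : Ω) :
    EuclideanSpace ℝ (Fin d) :=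
  WithLp.toLp 2 ((σ ^ 2)⁻¹ • ((𝓑.precision lam σ t ω)⁻¹).mulVec
    (∑ s ∈ 𝓑.observed t ω, 𝓑.y s ω • (𝓑.x s ω).ofLp))

/-- The map that turns a standard normal vector `z` into a draw from the posterior
`N (posteriorMean, ν² precision⁻¹)`. -/
def posteriorDraw (𝓑 : DelayedLinearBandit d T B f P) (lam σ ν : ℝ) (t : ℕ) (ω : Ω)
    (z : EuclideanSpace ℝ (Fin d)) : EuclideanSpace ℝ (Fin d) :=
  𝓑.posteriorMean lam σ t ω +
    Matrix.toEuclideanCLM (𝕜 := ℝ) (CFC.sqrt (ν ^ 2 • (𝓑.precision lam σ t ω)⁻¹)) z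

lemma map_posteriorDraw (𝓑 : DelayedLinearBandit d T B f P) (lam σ ν : ℝ) (t : ℕ) (ω : Ω) :
    (stdGaussian (EuclideanSpace ℝ (Fin d))).map (𝓑.posteriorDraw lam σ ν t ω) =
      multivariateGaussian (𝓑.posteriorMean lam σ t ω)
        (ν ^ 2 • (𝓑.precision lam σ t ω)⁻¹) := rfl

/-- The learner is delayed posterior sampling (Delayed-PSLB) with `M` posterior draws per round,
scaling `ν`, regularisation `lam`, noise level `σ` and truncation level `u`: in round `t` it draws
`M` conditionally independent vectors `w 0, …, w (M - 1)` from the posterior given the observed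
feedback and plays an action that maximises `min (max_m ⟪a, w m⟫) u` over `D t`. Here `ζ t m` is
the standard normal vector behind the `m`-th draw of round `t`. Ties may be broken arbitrarily. -/
structure IsDelayedPSLB (𝓑 : DelayedLinearBandit d T B f P) (M : ℕ) (lam σ ν u : ℝ)
    (ζ : ℕ → Ω → Fin M → EuclideanSpace ℝ (Fin d)) : Prop where
  measurable_ζ : ∀ t < T, Measurable[𝓑.act t] (ζ t)
  law_ζ : ∀ t < T, P.map (ζ t) =
    Measure.pi fun _ : Fin M => stdGaussian (EuclideanSpace ℝ (Fin d))
  indep_ζ : ∀ t < T, Indep (MeasurableSpace.comap (ζ t) inferInstance) (𝓑.pre t) P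
  isMaxOn : ∀ t < T, ∀ ω, IsMaxOn
    (fun a => min (⨆ m : Fin M, inner ℝ a (𝓑.posteriorDraw lam σ ν t ω (ζ t ω m))) u)
    (𝓑.D t ω) (𝓑.x t ω)

end DelayedLinearBandit

/-! ### Parameters of the algorithm and the logarithmic factor -/

/-- The number of posterior draws per round, `⌈log (4 T / δ) / log (64 / 63)⌉`. -/
def pslbDraws (T : ℕ) (δ : ℝ) : ℕ :=
  ⌈Real.log (4 * T / δ) / Real.log (64 / 63)⌉₊

/-- The radius `C_δ` of the confidence ellipsoid, for regularisation `1` and noise level `1`. -/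
def pslbRadius (B : ℝ≥0) (d T : ℕ) (δ : ℝ) : ℝ :=
  B * √(d * Real.log (1 + T) + 2 * Real.log (T / δ)) + √(d : ℝ)

/-- The basic logarithm `1 + log (d T / δ)`; its powers are the polylogarithmic factors. -/
def pslbLog (d T : ℕ) (δ : ℝ) : ℝ := 1 + Real.log (d * T / δ)

end

/-! The argument is optimism by sampling, with the cost of the delays isolated in a deterministic
potential lemma. Four events are shown to fail with probability at most `δ / (4 * T)` in each round,
and a union bound makes all of them hold throughout.

Confidence: for fixed `t`, whether round `s` is observed in round `t` is decided by `τ s`, hence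
known before the noise of round `s`. The observed noise sum is therefore a martingale transform, and
the self-normalised inequality `measure_invQuad_gt_le` bounds it in the norm of the inverse
precision.

Optimism: in the direction of a best action the posterior standard deviation is `ν` times the
confidence scale, so each draw overshoots the truth with probability at least `1 / 64`; all `M`
draws fail with probability at most `(63 / 64) ^ M` (`measure_forall_supportFun_lt_le`).

Size: all coordinates of the normal vectors are at most `normalBound`. Backlog: the number of
missing rewards is a sum of independent indicators with mean at most the expected delay, so it is at
most `G`, of order mean delay plus logarithm (`measure_card_gt_le`).

On the good event the regret of a round is at most `ν * (3 / 2 + √d * r)` times the norm of the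
played action in the inverse observed precision (`supportFun_sub_inner_le`). These norms are summed
by `sum_sqrt_invQuad_delayed_le`. Actions are reweighted so that each has squared norm at most `1 /
G`; then `G` missing actions change the precision by a factor of at most two, and the ordinary
elliptical potential argument applies to the reweighted actions. Clipping costs a term linear in
`G`, so the delay enters additively. The prefactor is of order `d` and the sum of order `√(d * T) +
G * d`, up to logarithms, which gives the rates `√(d ^ 3 * T)` and `d ^ 2 * G`. -/

noncomputable section

open scoped MatrixOrder Matrix.Norms.L2Operator

/-! ### Quadratic forms, determinants and the elliptical potential -/

section QuadraticForms

open Matrix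

variable {n : Type*}

/-- The regularised Gram matrix of the vectors `x s` with `s ∈ I`. -/
def regGram [DecidableEq n] (x : ℕ → n → ℝ) (I : Finset ℕ) : Matrix n n ℝ := 1 + ∑ s ∈ I, vecMulVec (x s) (x s)

lemma regGram_empty [DecidableEq n] (x : ℕ → n → ℝ) : regGram x ∅ = 1 := by simp [regGram]

lemma regGram_range_succ [DecidableEq n] (x : ℕ → n → ℝ) (t : ℕ) :
    regGram x (Finset.range (t + 1)) = regGram x (Finset.range t) + vecMulVec (x t) (x t) := by
  rw [regGram, regGram, Finset.sum_range_succ, add_assoc]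

lemma Matrix.PosDef.transpose_eq {A : Matrix n n ℝ} (hA : A.PosDef) : Aᵀ = A := by
  have h := hA.isHermitian
  rwa [Matrix.IsHermitian, conjTranspose_eq_transpose_of_trivial] at h

variable [Fintype n]

lemma dotProduct_mulVec_comm_of_transpose_eq {A : Matrix n n ℝ} (hA : Aᵀ = A) (x y : n → ℝ) :
    x ⬝ᵥ A *ᵥ y = y ⬝ᵥ A *ᵥ x := by
  rw [dotProduct_mulVec, ← mulVec_transpose, hA, dotProduct_comm]

lemma Matrix.PosDef.dotProduct_mulVec_nonneg' {A : Matrix n n ℝ} (hA : A.PosDef) (x : n → ℝ) :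
    0 ≤ x ⬝ᵥ A *ᵥ x := by
  simpa using hA.posSemidef.dotProduct_mulVec_nonneg x

lemma posSemidef_vecMulVec_self (x : n → ℝ) : (vecMulVec x x).PosSemidef := by
  simpa using posSemidef_vecMulVec_self_star x

lemma dotProduct_vecMulVec_mulVec (x y z : n → ℝ) :
    y ⬝ᵥ vecMulVec x x *ᵥ z = (x ⬝ᵥ y) * (x ⬝ᵥ z) := by
  rw [vecMulVec_mulVec]
  simp [dotProduct_smul, dotProduct_comm y x, mul_comm]

lemma Matrix.PosDef.add_vecMulVec {A : Matrix n n ℝ} (hA : A.PosDef) (x : n → ℝ) :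
    (A + vecMulVec x x).PosDef := hA.add_posSemidef (posSemidef_vecMulVec_self x)

variable [DecidableEq n]


/-- The quadratic form of the inverse of a matrix. -/
def invQuad (A : Matrix n n ℝ) (x : n → ℝ) : ℝ := x ⬝ᵥ A⁻¹ *ᵥ x

lemma Matrix.PosDef.mulVec_inv_mulVec {A : Matrix n n ℝ} (hA : A.PosDef) (x : n → ℝ) :
    A *ᵥ (A⁻¹ *ᵥ x) = x := by
  rw [mulVec_mulVec, mul_nonsing_inv _ ((isUnit_iff_isUnit_det A).1 hA.isUnit), one_mulVec]

lemma Matrix.PosDef.inv_mulVec_mulVec {A : Matrix n n ℝ} (hA : A.PosDef) (x : n → ℝ) :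
    A⁻¹ *ᵥ (A *ᵥ x) = x := by
  rw [mulVec_mulVec, nonsing_inv_mul _ ((isUnit_iff_isUnit_det A).1 hA.isUnit), one_mulVec]

lemma invQuad_nonneg {A : Matrix n n ℝ} (hA : A.PosDef) (x : n → ℝ) : 0 ≤ invQuad A x :=
  hA.inv.dotProduct_mulVec_nonneg' x

lemma invQuad_smul (A : Matrix n n ℝ) (c : ℝ) (x : n → ℝ) :
    invQuad A (c • x) = c ^ 2 * invQuad A x := by
  simp only [invQuad, mulVec_smul, smul_dotProduct, dotProduct_smul, smul_eq_mul]; ring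

lemma invQuad_one (x : n → ℝ) : invQuad (1 : Matrix n n ℝ) x = x ⬝ᵥ x := by simp [invQuad]

/-- Cauchy-Schwarz for a positive definite form and its dual. -/
lemma sq_dotProduct_le_invQuad_mul {A : Matrix n n ℝ} (hA : A.PosDef) (x y : n → ℝ) :
    (x ⬝ᵥ y) ^ 2 ≤ invQuad A x * (y ⬝ᵥ A *ᵥ y) := by
  have key : ∀ t : ℝ, 0 ≤ invQuad A x * (t * t) + (-2 * (x ⬝ᵥ y)) * t + y ⬝ᵥ A *ᵥ y := by
    intro t
    have h := hA.dotProduct_mulVec_nonneg' (y - t • (A⁻¹ *ᵥ x))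
    have e1 : (A⁻¹ *ᵥ x) ⬝ᵥ A *ᵥ y = x ⬝ᵥ y := by
      rw [dotProduct_mulVec_comm_of_transpose_eq hA.transpose_eq, hA.mulVec_inv_mulVec,
        dotProduct_comm]
    have e2 : (A⁻¹ *ᵥ x) ⬝ᵥ x = invQuad A x := dotProduct_comm _ _
    simp only [mulVec_sub, mulVec_smul, sub_dotProduct, dotProduct_sub, smul_dotProduct,
      dotProduct_smul, hA.mulVec_inv_mulVec, smul_eq_mul, e1, e2, dotProduct_comm y x] at h
    linarith
  have h := discrim_le_zero key
  rw [discrim] at h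
  nlinarith

lemma sq_dotProduct_inv_le {A : Matrix n n ℝ} (hA : A.PosDef) (x y : n → ℝ) :
    (x ⬝ᵥ A⁻¹ *ᵥ y) ^ 2 ≤ invQuad A x * invQuad A y := by
  have h := sq_dotProduct_le_invQuad_mul hA x (A⁻¹ *ᵥ y)
  rwa [hA.mulVec_inv_mulVec, dotProduct_comm (A⁻¹ *ᵥ y) y] at h

/-- Inversion reverses the Loewner order: apply Cauchy-Schwarz with the test vector `A'⁻¹ *ᵥ x` and
cancel one factor. -/
lemma invQuad_le_of_forall_le {A A' : Matrix n n ℝ} (hA : A.PosDef) (hA' : A'.PosDef)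
    (h : ∀ y, y ⬝ᵥ A *ᵥ y ≤ y ⬝ᵥ A' *ᵥ y) (x : n → ℝ) : invQuad A' x ≤ invQuad A x := by
  have h1 := sq_dotProduct_le_invQuad_mul hA x (A'⁻¹ *ᵥ x)
  have h2 := h (A'⁻¹ *ᵥ x)
  rw [hA'.mulVec_inv_mulVec, dotProduct_comm _ x] at h2
  change invQuad A' x ^ 2 ≤ _ at h1
  change _ ≤ invQuad A' x at h2
  have h3 := invQuad_nonneg hA x
  rcases (invQuad_nonneg hA' x).eq_or_lt with h4 | h4
  · rw [← h4]; exact h3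
  · nlinarith

lemma Matrix.PosDef.det_add_vecMulVec {A : Matrix n n ℝ} (hA : A.PosDef) (x : n → ℝ) :
    (A + vecMulVec x x).det = A.det * (1 + invQuad A x) := by
  have h := det_add_replicateCol_mul_replicateRow (ι := Unit)
    ((isUnit_iff_isUnit_det A).1 hA.isUnit) x x
  rw [vecMulVec_eq Unit, h, Matrix.mul_assoc]
  congr 1
  rw [det_unique]
  simp only [add_apply, one_apply_eq, add_right_inj, invQuad]
  rfl

/-- Sherman-Morrison, as an identity of quadratic forms. -/
lemma invQuad_add_vecMulVec {A : Matrix n n ℝ} (hA : A.PosDef) (x y : n → ℝ) :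
    invQuad (A + vecMulVec x x) y = invQuad A y - (x ⬝ᵥ A⁻¹ *ᵥ y) ^ 2 / (1 + invQuad A x) := by
  have hm : 0 < 1 + invQuad A x := by linarith [invQuad_nonneg hA x]
  -- The candidate solution of `(A + x xᵀ) w = y`; checking it avoids computing the inverse matrix.
  set w := A⁻¹ *ᵥ y - ((x ⬝ᵥ A⁻¹ *ᵥ y) / (1 + invQuad A x)) • (A⁻¹ *ᵥ x) with hw
  have h1 : (A + vecMulVec x x) *ᵥ w = y := by
    rw [hw, mulVec_sub, add_mulVec, mulVec_smul, add_mulVec, hA.mulVec_inv_mulVec,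
      hA.mulVec_inv_mulVec, vecMulVec_mulVec, vecMulVec_mulVec]
    ext i
    have : x ⬝ᵥ A⁻¹ *ᵥ x = invQuad A x := rfl
    simp only [this, Pi.sub_apply, Pi.add_apply, Pi.smul_apply, MulOpposite.smul_eq_mul_unop,
      MulOpposite.unop_op, smul_eq_mul]
    field_simp
    ring
  have h2 : (A + vecMulVec x x)⁻¹ *ᵥ y = w := by
    conv_lhs => rw [← h1]
    exact (hA.add_vecMulVec x).inv_mulVec_mulVec w
  rw [invQuad, h2, hw, dotProduct_sub, dotProduct_smul, smul_eq_mul, invQuad,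
    dotProduct_mulVec_comm_of_transpose_eq hA.inv.transpose_eq y x, invQuad]
  ring

lemma posDef_regGram (x : ℕ → n → ℝ) (I : Finset ℕ) : (regGram x I).PosDef :=
  PosDef.one.add_posSemidef (posSemidef_sum _ fun s _ => posSemidef_vecMulVec_self (x s))

lemma dotProduct_regGram_mulVec (x : ℕ → n → ℝ) (I : Finset ℕ) (y : n → ℝ) :
    y ⬝ᵥ regGram x I *ᵥ y = y ⬝ᵥ y + ∑ s ∈ I, (x s ⬝ᵥ y) ^ 2 := by
  simp only [regGram, add_mulVec, one_mulVec, dotProduct_add, sum_mulVec, dotProduct_sum,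
    dotProduct_vecMulVec_mulVec, sq]

lemma invQuad_regGram_anti (x : ℕ → n → ℝ) {I J : Finset ℕ} (h : I ⊆ J) (y : n → ℝ) :
    invQuad (regGram x J) y ≤ invQuad (regGram x I) y := by
  refine invQuad_le_of_forall_le (posDef_regGram x I) (posDef_regGram x J) (fun z => ?_) y
  rw [dotProduct_regGram_mulVec, dotProduct_regGram_mulVec]
  have := Finset.sum_le_sum_of_subset_of_nonneg h fun s _ _ => sq_nonneg (x s ⬝ᵥ z)
  linarith

lemma invQuad_regGram_le (x : ℕ → n → ℝ) (I : Finset ℕ) (y : n → ℝ) :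
    invQuad (regGram x I) y ≤ y ⬝ᵥ y := by
  have := invQuad_regGram_anti x (Finset.empty_subset I) y
  rwa [regGram_empty, invQuad_one] at this

lemma det_regGram_pos (x : ℕ → n → ℝ) (I : Finset ℕ) : 0 < (regGram x I).det := (posDef_regGram x I).det_pos

/-- The determinant is the product of the eigenvalues, and each is the value of the form at a unit
eigenvector, where every rank-one term contributes at most 1. -/
lemma det_regGram_le (x : ℕ → n → ℝ) (I : Finset ℕ) (hx : ∀ s ∈ I, x s ⬝ᵥ x s ≤ 1) :
    (regGram x I).det ≤ (1 + (I.card : ℝ)) ^ Fintype.card n := by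
  have hA := (posDef_regGram x I).isHermitian
  rw [hA.det_eq_prod_eigenvalues, Fintype.card, ← Finset.prod_const]
  refine Finset.prod_le_prod (fun i _ => ?_) fun i _ => ?_
  · exact ((posDef_regGram x I).eigenvalues_pos i).le
  · have hn : (hA.eigenvectorBasis i).ofLp ⬝ᵥ (hA.eigenvectorBasis i).ofLp = 1 := by
      have := hA.eigenvectorBasis.norm_eq_one i
      have h2 := EuclideanSpace.real_norm_sq_eq (hA.eigenvectorBasis i)
      rw [this] at h2
      simp only [dotProduct, ← sq]
      linarith
    have e := hA.eigenvalues_eq i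
    simp only [star_trivial, RCLike.re_to_real] at e
    rw [dotProduct_regGram_mulVec, hn] at e
    simp only [RCLike.ofReal_real_eq_id, id_eq]
    rw [e]
    gcongr
    rw [Finset.card_eq_sum_ones, Nat.cast_sum]
    refine Finset.sum_le_sum fun s hs => ?_
    have h3 := sq_dotProduct_le_invQuad_mul (PosDef.one (n := n) (R := ℝ)) (x s)
      (hA.eigenvectorBasis i).ofLp
    rw [invQuad_one, one_mulVec, hn] at h3
    have := hx s hs
    push_cast
    linarith

/-- Each rank-one update multiplies the determinant by `1 + invQuad`, so the logarithms telescope.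
-/
lemma sum_log_one_add_invQuad (x : ℕ → n → ℝ) (T : ℕ) :
    ∑ t ∈ Finset.range T, Real.log (1 + invQuad (regGram x (Finset.range t)) (x t)) =
      Real.log (regGram x (Finset.range T)).det := by
  induction T with
  | zero => simp [regGram_empty]
  | succ T ih =>
    rw [Finset.sum_range_succ, ih, regGram_range_succ, (posDef_regGram x _).det_add_vecMulVec,
      Real.log_mul (det_regGram_pos x _).ne']
    linarith [invQuad_nonneg (posDef_regGram x (Finset.range T)) (x T)]

/-- The elliptical potential lemma. -/
lemma sum_invQuad_regGram_le (x : ℕ → n → ℝ) (T : ℕ) (hx : ∀ t < T, x t ⬝ᵥ x t ≤ 1) :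
    ∑ t ∈ Finset.range T, invQuad (regGram x (Finset.range t)) (x t) ≤
      2 * Fintype.card n * Real.log (1 + T) := by
  have h1 : ∑ t ∈ Finset.range T, invQuad (regGram x (Finset.range t)) (x t) ≤
      ∑ t ∈ Finset.range T, 2 * Real.log (1 + invQuad (regGram x (Finset.range t)) (x t)) := by
    refine Finset.sum_le_sum fun t ht => ?_
    have h0 := invQuad_nonneg (posDef_regGram x (Finset.range t)) (x t)
    have h1 := (invQuad_regGram_le x (Finset.range t) (x t)).trans (hx t (Finset.mem_range.1 ht))
    set a := invQuad (regGram x (Finset.range t)) (x t)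
    have h2 := Real.one_sub_inv_le_log_of_pos (show 0 < 1 + a by linarith)
    -- This is where `a ≤ 1` is needed: it gives `a ≤ 2 * log (1 + a)`.
    have h3 : a / 2 ≤ 1 - (1 + a)⁻¹ := by
      rw [← sub_nonneg]
      have : 1 - (1 + a)⁻¹ - a / 2 = a * (1 - a) / (2 * (1 + a)) := by
        field_simp; ring
      rw [this]
      exact div_nonneg (mul_nonneg h0 (by linarith)) (by linarith)
    linarith
  refine h1.trans ?_
  rw [← Finset.mul_sum, sum_log_one_add_invQuad]
  have h2 := det_regGram_le x (Finset.range T) fun s hs => hx s (Finset.mem_range.1 hs)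
  have h3 := Real.log_le_log (det_regGram_pos x _) h2
  rw [Real.log_pow, Finset.card_range] at h3
  linarith

/-- Dropping the vectors of `U` inflates the inverse form by at most `1 + K`, where `K` bounds their
total squared norm in `A⁻¹`. Cauchy-Schwarz is tested at `A⁻¹ *ᵥ x`, and each dropped term is at
most `invQuad A (z s) * invQuad A x`. -/
lemma invQuad_le_mul_of_forall_le {A A' : Matrix n n ℝ} (hA : A.PosDef) (hA' : A'.PosDef)
    {z : ℕ → n → ℝ} {U : Finset ℕ} (h : ∀ y, y ⬝ᵥ A' *ᵥ y ≤ y ⬝ᵥ A *ᵥ y + ∑ s ∈ U, (z s ⬝ᵥ y) ^ 2)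
    {K : ℝ} (hK : ∑ s ∈ U, invQuad A (z s) ≤ K) (x : n → ℝ) :
    invQuad A x ≤ (1 + K) * invQuad A' x := by
  have h1 := sq_dotProduct_le_invQuad_mul hA' x (A⁻¹ *ᵥ x)
  have h2 := h (A⁻¹ *ᵥ x)
  rw [hA.mulVec_inv_mulVec, dotProduct_comm _ x] at h2
  change invQuad A x ^ 2 ≤ _ at h1
  change _ ≤ invQuad A x + _ at h2
  have ha := invQuad_nonneg hA x
  have h3 : ∑ s ∈ U, (z s ⬝ᵥ A⁻¹ *ᵥ x) ^ 2 ≤ K * invQuad A x := by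
    calc _ ≤ ∑ s ∈ U, invQuad A (z s) * invQuad A x :=
          Finset.sum_le_sum fun s _ => sq_dotProduct_inv_le hA _ _
      _ = (∑ s ∈ U, invQuad A (z s)) * invQuad A x := by rw [Finset.sum_mul]
      _ ≤ _ := mul_le_mul_of_nonneg_right hK ha
  have hb := invQuad_nonneg hA' x
  have hK0 : 0 ≤ K := (Finset.sum_nonneg fun s _ => invQuad_nonneg hA _).trans hK
  rcases ha.eq_or_lt with h4 | h4
  · rw [← h4]; positivity
  · have : invQuad A x * invQuad A x ≤ (1 + K) * invQuad A' x * invQuad A x := by nlinarith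
    exact le_of_mul_le_mul_right this h4

/-- The elliptical potential lemma with delayed observations: if at most `G` of the previous rounds
are unobserved in each round, the delay costs an additive term of order `G`. -/
lemma sum_sqrt_invQuad_delayed_le (x : ℕ → n → ℝ) (T : ℕ) (hx : ∀ t < T, x t ⬝ᵥ x t ≤ 1)
    (O : ℕ → Finset ℕ) (hO : ∀ t, O t ⊆ Finset.range t) (hmono : Monotone O) {G : ℝ} (hG : 1 ≤ G)
    (hU : ∀ t < T, ((Finset.range t \ O t).card : ℝ) ≤ G) :
    ∑ t ∈ Finset.range T, √(invQuad (regGram x (O t)) (x t)) ≤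
      √(T * (4 * Fintype.card n * Real.log (1 + T))) + G * (4 * Fintype.card n * Real.log (1 + T)) := by
  set a : ℕ → ℝ := fun t => invQuad (regGram x (O t)) (x t) with ha
  have ha0 : ∀ t, 0 ≤ a t := fun t => invQuad_nonneg (posDef_regGram x _) _
  have ha1 : ∀ t < T, a t ≤ 1 := fun t ht => (invQuad_regGram_le x _ _).trans (hx t ht)
  -- clipped weights
  set c : ℕ → ℝ := fun t => min (a t) (1 / G) with hc
  have hG0 : 0 < G := by linarith
  have hc0 : ∀ t, 0 ≤ c t := fun t => le_min (ha0 t) (by positivity)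
  -- Weights chosen so that the reweighted action `√(w t) • x t` has squared norm exactly `c t = min
  -- (a t) (1 / G)` in the observed geometry of its own round.
  set w : ℕ → ℝ := fun t => if a t ≤ 1 / G then 1 else 1 / (G * a t) with hw
  have hwa : ∀ t, w t * a t = c t := by
    intro t
    simp only [hw, hc]
    split_ifs with h
    · rw [min_eq_left h, one_mul]
    · have : 0 < a t := lt_of_lt_of_le (by positivity) (not_le.1 h).le
      rw [min_eq_right (not_le.1 h).le]; field_simp
  have hw0 : ∀ t, 0 ≤ w t := by
    intro t; simp only [hw]; split_ifs
    · exact zero_le_one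
    · have := ha0 t; positivity
  have hw1 : ∀ t, w t ≤ 1 := by
    intro t; simp only [hw]; split_ifs with h
    · exact le_rfl
    · have h' := not_le.1 h
      have : 0 < a t := lt_of_lt_of_le (by positivity) h'.le
      rw [div_lt_iff₀ hG0] at h'
      rw [div_le_one (by positivity)]; linarith
  set z : ℕ → n → ℝ := fun t => √(w t) • x t with hz
  have hzy : ∀ t y, (z t ⬝ᵥ y) ^ 2 = w t * (x t ⬝ᵥ y) ^ 2 := by
    intro t y
    simp only [hz, smul_dotProduct, smul_eq_mul, mul_pow, Real.sq_sqrt (hw0 t)]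
  have hzz : ∀ t < T, z t ⬝ᵥ z t ≤ 1 := by
    intro t ht
    have : z t ⬝ᵥ z t = w t * (x t ⬝ᵥ x t) := by
      simp only [hz, smul_dotProduct, dotProduct_smul, smul_eq_mul, ← mul_assoc,
        Real.mul_self_sqrt (hw0 t)]
    rw [this]
    have h0 : 0 ≤ x t ⬝ᵥ x t := by simpa using dotProduct_star_self_nonneg (x t)
    nlinarith [hw0 t, hw1 t, hx t ht]
  have hpot := sum_invQuad_regGram_le z T hzz
  have hstep : ∀ t ∈ Finset.range T, c t ≤ 2 * invQuad (regGram z (Finset.range t)) (z t) := by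
    intro t ht
    have ht' := Finset.mem_range.1 ht
    -- Compare observed, unweighted information with complete, reweighted information. Observed
    -- rounds only lose weight; each missing one contributes at most `1 / G`, since its norm has not
    -- grown since its own round (`O` is monotone). The at most `G` missing rounds thus add up to `K
    -- = 1`.
    have key : invQuad (regGram x (O t)) (x t) ≤ (1 + 1) * invQuad (regGram z (Finset.range t)) (x t) := by
      refine invQuad_le_mul_of_forall_le (U := Finset.range t \ O t) (z := z) (posDef_regGram _ _)
        (posDef_regGram _ _) (fun y => ?_) ?_ (x t)
      · rw [dotProduct_regGram_mulVec, dotProduct_regGram_mulVec, ← Finset.sum_sdiff (hO t)]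
        have : ∑ s ∈ O t, (z s ⬝ᵥ y) ^ 2 ≤ ∑ s ∈ O t, (x s ⬝ᵥ y) ^ 2 := by
          refine Finset.sum_le_sum fun s _ => ?_
          rw [hzy]
          exact mul_le_of_le_one_left (sq_nonneg _) (hw1 s)
        linarith
      · calc ∑ s ∈ Finset.range t \ O t, invQuad (regGram x (O t)) (z s)
            ≤ ∑ s ∈ Finset.range t \ O t, 1 / G := by
              refine Finset.sum_le_sum fun s hs => ?_
              have hst : s ≤ t := (Finset.mem_range.1 (Finset.mem_sdiff.1 hs).1).le
              rw [hz, invQuad_smul, Real.sq_sqrt (hw0 s)]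
              calc _ ≤ w s * a s :=
                    mul_le_mul_of_nonneg_left (invQuad_regGram_anti x (hmono hst) (x s)) (hw0 s)
                _ = c s := hwa s
                _ ≤ 1 / G := min_le_right _ _
          _ = ((Finset.range t \ O t).card : ℝ) * (1 / G) := by
              rw [Finset.sum_const, nsmul_eq_mul]
          _ ≤ G * (1 / G) := mul_le_mul_of_nonneg_right (hU t ht') (by positivity)
          _ = 1 := by field_simp
    rw [← hwa, hz, invQuad_smul, Real.sq_sqrt (hw0 t)]
    have := mul_le_mul_of_nonneg_left key (hw0 t)
    change w t * a t ≤ _ at this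
    linarith
  have hD : ∑ t ∈ Finset.range T, c t ≤ 4 * Fintype.card n * Real.log (1 + T) := by
    have := Finset.sum_le_sum hstep
    rw [← Finset.mul_sum] at this
    linarith
  set D := 4 * Fintype.card n * Real.log (1 + T)
  -- In a clipped round `G * c t = 1` already dominates `√(a t)`; this is the source of the additive
  -- term.
  have hpt : ∀ t ∈ Finset.range T, √(a t) ≤ √(c t) + G * c t := by
    intro t ht
    by_cases h : a t ≤ 1 / G
    · have : c t = a t := min_eq_left h
      rw [this]
      have := ha0 t
      have : 0 ≤ G * a t := by positivity
      linarith
    · have : c t = 1 / G := min_eq_right (not_le.1 h).le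
      have h1 : √(a t) ≤ 1 := Real.sqrt_le_one.2 (ha1 t (Finset.mem_range.1 ht))
      have h2 : G * c t = 1 := by rw [this]; field_simp
      have := Real.sqrt_nonneg (c t)
      linarith
  calc _ ≤ ∑ t ∈ Finset.range T, (√(c t) + G * c t) := Finset.sum_le_sum hpt
    _ = ∑ t ∈ Finset.range T, √(c t) + G * ∑ t ∈ Finset.range T, c t := by
        rw [Finset.sum_add_distrib, Finset.mul_sum]
    _ ≤ √(T * D) + G * D := by
        gcongr
        apply Real.le_sqrt_of_sq_le
        have := sq_sum_le_card_mul_sum_sq (s := Finset.range T) (f := fun t => √(c t))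
        simp only [Real.sq_sqrt (hc0 _), Finset.card_range] at this
        exact this.trans (mul_le_mul_of_nonneg_left hD (by positivity))

end QuadraticForms

/-! ### One-dimensional Gaussian mixtures of exponential martingale factors -/

section Mixture

open scoped ENNReal

/-- Completing the square: tilting `N(s, m)` by this factor gives a constant times the Gaussian with
mean `(m * y + s) / (1 + m)` and variance `m / (1 + m)`. -/
lemma lintegral_exp_sub_sq_gaussianReal (y s : ℝ) {m : ℝ≥0} (hm : m ≠ 0) :
    ∫⁻ γ, ENNReal.ofReal (Real.exp (γ * y - γ ^ 2 / 2)) ∂(gaussianReal s m) =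
      ENNReal.ofReal ((√(1 + m))⁻¹ *
        Real.exp ((2 * y * s + y ^ 2 * m - s ^ 2) / (2 * (1 + m)))) := by
  have hm0 : (0 : ℝ) < m := by exact_mod_cast pos_iff_ne_zero.2 hm
  have h1m : (0 : ℝ) < 1 + m := by linarith
  set v : ℝ≥0 := m / (1 + m) with hv
  have hv' : (v : ℝ) = m / (1 + m) := by simp [hv]
  have hv0 : v ≠ 0 := by simp [hv, hm]
  set C := (√(1 + m))⁻¹ * Real.exp ((2 * y * s + y ^ 2 * m - s ^ 2) / (2 * (1 + m))) with hC
  have hC0 : 0 ≤ C := by positivity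
  have key : ∀ γ, Real.exp (γ * y - γ ^ 2 / 2) * gaussianPDFReal s m γ =
      C * gaussianPDFReal ((m * y + s) / (1 + m)) v γ := by
    intro γ
    simp only [gaussianPDFReal, hv', hC]
    have e1 : (√(2 * Real.pi * (m / (1 + m))))⁻¹ = √(1 + m) * (√(2 * Real.pi * m))⁻¹ := by
      rw [← mul_div_assoc, Real.sqrt_div (by positivity), inv_div, div_eq_mul_inv]
    rw [e1]
    have h2 : √(1 + (m : ℝ)) ≠ 0 := (Real.sqrt_pos.2 h1m).ne'
    calc _ = (√(2 * Real.pi * m))⁻¹ *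
          Real.exp (γ * y - γ ^ 2 / 2 + -(γ - s) ^ 2 / (2 * m)) := by rw [Real.exp_add]; ring
      _ = (√(2 * Real.pi * m))⁻¹ *
          Real.exp ((2 * y * s + y ^ 2 * m - s ^ 2) / (2 * (1 + m)) +
            -(γ - (m * y + s) / (1 + m)) ^ 2 / (2 * (m / (1 + m)))) := by
        congr 2
        field_simp
        ring
      _ = _ := by rw [Real.exp_add]; field_simp
  rw [gaussianReal_of_var_ne_zero _ hm,
    lintegral_withDensity_eq_lintegral_mul _ (measurable_gaussianPDF s m) (by fun_prop)]
  calc _ = ∫⁻ γ, ENNReal.ofReal C * gaussianPDF ((m * y + s) / (1 + m)) v γ := by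
        refine lintegral_congr fun γ => ?_
        simp only [Pi.mul_apply, gaussianPDF]
        rw [mul_comm, ← ENNReal.ofReal_mul (by positivity), key, ENNReal.ofReal_mul hC0]
    _ = ENNReal.ofReal C := by
        rw [lintegral_const_mul _ (measurable_gaussianPDF _ _), lintegral_gaussianPDF_eq_one _ hv0,
          mul_one]

/-- The integrand is the mixture of `exp (γ * Y - γ ^ 2 / 2)` over `γ ∼ N(s, m)`. Each member has
integral at most 1, so Tonelli gives the bound; for `m = 0` the mixture is the single member `γ =
s`. -/
lemma lintegral_exp_quadratic_le {Ω : Type*} [MeasurableSpace Ω] (κ : Measure Ω) [SFinite κ]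
    {Y : Ω → ℝ} (hY : Measurable Y)
    (h : ∀ γ : ℝ, ∫⁻ ω, ENNReal.ofReal (Real.exp (γ * Y ω)) ∂κ ≤
      ENNReal.ofReal (Real.exp (γ ^ 2 / 2))) (s : ℝ) {m : ℝ} (hm : 0 ≤ m) :
    ∫⁻ ω, ENNReal.ofReal ((√(1 + m))⁻¹ *
        Real.exp ((2 * Y ω * s + Y ω ^ 2 * m - s ^ 2) / (2 * (1 + m)))) ∂κ ≤ 1 := by
  have h' : ∀ γ : ℝ, ∫⁻ ω, ENNReal.ofReal (Real.exp (γ * Y ω - γ ^ 2 / 2)) ∂κ ≤ 1 := by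
    intro γ
    calc _ = ∫⁻ ω, ENNReal.ofReal (Real.exp (-(γ ^ 2 / 2))) *
            ENNReal.ofReal (Real.exp (γ * Y ω)) ∂κ := by
          refine lintegral_congr fun ω => ?_
          rw [← ENNReal.ofReal_mul (Real.exp_pos _).le, ← Real.exp_add]
          congr 2; ring
      _ = ENNReal.ofReal (Real.exp (-(γ ^ 2 / 2))) *
            ∫⁻ ω, ENNReal.ofReal (Real.exp (γ * Y ω)) ∂κ :=
          lintegral_const_mul _ (by fun_prop)
      _ ≤ ENNReal.ofReal (Real.exp (-(γ ^ 2 / 2))) * ENNReal.ofReal (Real.exp (γ ^ 2 / 2)) := by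
          gcongr; exact h γ
      _ = 1 := by
          rw [← ENNReal.ofReal_mul (Real.exp_pos _).le, ← Real.exp_add]; simp
  lift m to ℝ≥0 using hm
  by_cases hm0 : m = 0
  · subst hm0
    refine le_trans (le_of_eq (lintegral_congr fun ω => ?_)) (h' s)
    simp only [NNReal.coe_zero, add_zero, Real.sqrt_one, inv_one, one_mul, mul_zero, mul_one]
    congr 2; ring
  · simp_rw [← lintegral_exp_sub_sq_gaussianReal _ s hm0]
    rw [lintegral_lintegral_swap (by fun_prop)]
    calc _ ≤ ∫⁻ _, 1 ∂(gaussianReal s m) := lintegral_mono fun γ => h' γ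
      _ = 1 := by simp

end Mixture

/-! ### Disintegration along a sub-σ-algebra -/

section Conditioning

open scoped ENNReal

variable {Ω : Type*} {m mΩ : MeasurableSpace Ω} [StandardBorelSpace Ω] {P : Measure Ω}
  [IsFiniteMeasure P]

/-- Freezes the variables known under `m` while integrating the rest against the conditional law:
`P.trim hm` composed with the kernel is the law of `(ω, ω)`. -/
lemma lintegral_diag_eq_lintegral_condExpKernel (hm : m ≤ mΩ) {g : Ω × Ω → ℝ≥0∞}
    (hg : Measurable[m.prod mΩ] g) :
    ∫⁻ ω, g (ω, ω) ∂P = ∫⁻ ω, ∫⁻ ω', g (ω, ω') ∂(condExpKernel P m ω) ∂(P.trim hm) := by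
  have h1 : @Measurable Ω (Ω × Ω) mΩ (m.prod mΩ) Function.diag :=
    (measurable_id'' hm).prodMk measurable_id
  have h2 := @lintegral_map Ω (Ω × Ω) mΩ (m.prod mΩ) P g Function.diag hg h1
  change _ = ∫⁻ ω, g (ω, ω) ∂P at h2
  rw [← h2, ← compProd_trim_condExpKernel hm]
  exact Measure.lintegral_compProd hg

lemma HasCondSubgaussianMGF.ae_lintegral_exp_le {hm : m ≤ mΩ} {Y : Ω → ℝ} {c : ℝ≥0}
    (h : HasCondSubgaussianMGF m hm Y c P) {σ : ℝ} (hσ : 0 < σ) (hc : (c : ℝ) ≤ σ ^ 2) :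
    ∀ᵐ ω ∂(P.trim hm), ∀ γ : ℝ,
      ∫⁻ ω', ENNReal.ofReal (Real.exp (γ * (Y ω' / σ))) ∂(condExpKernel P m ω) ≤
        ENNReal.ofReal (Real.exp (γ ^ 2 / 2)) := by
  filter_upwards [h.mgf_le, Kernel.HasSubgaussianMGF.ae_forall_integrable_exp_mul h]
    with ω h1 h2 γ
  have e : ∀ ω', γ * (Y ω' / σ) = (γ / σ) * Y ω' := fun ω' => by ring
  simp_rw [e]
  rw [← ofReal_integral_eq_lintegral_ofReal (h2 _) (ae_of_all _ fun _ => (Real.exp_pos _).le)]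
  refine ENNReal.ofReal_le_ofReal ((h1 (γ / σ)).trans (Real.exp_le_exp.2 ?_))
  have : (c : ℝ) * (γ / σ) ^ 2 ≤ γ ^ 2 := by
    rw [div_pow, ← mul_div_assoc, div_le_iff₀ (by positivity), mul_comm]
    gcongr
  linarith

end Conditioning

/-! ### Measurability of determinants and inverses -/

section MatrixMeasurability

variable {Ω : Type*} [MeasurableSpace Ω] {n : Type*} [DecidableEq n]

lemma measurable_regGram_apply {x : ℕ → Ω → n → ℝ} {I : Finset ℕ} (hx : ∀ s ∈ I, Measurable (x s))
    (i j : n) : Measurable fun ω => regGram (fun s => x s ω) I i j := by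
  simp only [regGram, Matrix.add_apply, Matrix.sum_apply, Matrix.vecMulVec_apply]
  exact measurable_const.add (Finset.measurable_sum _ fun s hs =>
    (measurable_pi_iff.1 (hx s hs) i).mul (measurable_pi_iff.1 (hx s hs) j))

variable [Fintype n]

lemma measurable_det {A : Ω → Matrix n n ℝ} (hA : ∀ i j, Measurable fun ω => A ω i j) :
    Measurable fun ω => (A ω).det := by
  simp only [Matrix.det_apply]
  exact Finset.measurable_sum _ fun σ _ =>
    (Finset.measurable_prod _ fun i _ => hA _ _).const_smul _

lemma measurable_inv_apply {A : Ω → Matrix n n ℝ} (hA : ∀ i j, Measurable fun ω => A ω i j)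
    (i j : n) : Measurable fun ω => (A ω)⁻¹ i j := by
  simp only [Matrix.inv_def, Matrix.smul_apply, Ring.inverse_eq_inv', smul_eq_mul,
    Matrix.adjugate_apply]
  refine (measurable_det hA).inv.mul (measurable_det fun k l => ?_)
  simp only [Matrix.updateRow_apply]
  split_ifs
  · exact measurable_const
  · exact hA k l

lemma measurable_dotProduct_inv_mulVec {A : Ω → Matrix n n ℝ} {x y : Ω → n → ℝ}
    (hA : ∀ i j, Measurable fun ω => A ω i j) (hx : Measurable x) (hy : Measurable y) :
    Measurable fun ω => x ω ⬝ᵥ (A ω)⁻¹.mulVec (y ω) := by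
  simp only [dotProduct, Matrix.mulVec]
  exact Finset.measurable_sum _ fun i _ => (measurable_pi_iff.1 hx i).mul
    (Finset.measurable_sum _ fun j _ => (measurable_inv_apply hA i j).mul (measurable_pi_iff.1 hy j))

end MatrixMeasurability

/-! ### The self-normalised martingale inequality -/

section SelfNormalized

open scoped ENNReal
open Matrix

variable {n : Type*} [Fintype n] [DecidableEq n]

lemma invQuad_add_vecMulVec_add_smul {A : Matrix n n ℝ} (hA : A.PosDef) (S x : n → ℝ) (η : ℝ) :
    invQuad (A + vecMulVec x x) (S + η • x) = invQuad A S +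
      (2 * η * (x ⬝ᵥ A⁻¹ *ᵥ S) + η ^ 2 * invQuad A x - (x ⬝ᵥ A⁻¹ *ᵥ S) ^ 2) /
        (1 + invQuad A x) := by
  have hm : 0 < 1 + invQuad A x := by linarith [invQuad_nonneg hA x]
  have e : S ⬝ᵥ A⁻¹ *ᵥ x = x ⬝ᵥ A⁻¹ *ᵥ S :=
    dotProduct_mulVec_comm_of_transpose_eq hA.inv.transpose_eq S x
  have e2 : x ⬝ᵥ A⁻¹ *ᵥ x = invQuad A x := rfl
  have e3 : invQuad A (S + η • x) =
      invQuad A S + 2 * η * (x ⬝ᵥ A⁻¹ *ᵥ S) + η ^ 2 * invQuad A x := by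
    rw [invQuad, invQuad]
    simp only [mulVec_add, mulVec_smul, add_dotProduct, dotProduct_add, smul_dotProduct,
      dotProduct_smul, smul_eq_mul, e, e2]
    ring
  rw [invQuad_add_vecMulVec hA, e3]
  simp only [mulVec_add, mulVec_smul, dotProduct_add, dotProduct_smul, smul_eq_mul, e2]
  field_simp
  ring

variable {Ω : Type*} [mΩ : MeasurableSpace Ω] [StandardBorelSpace Ω] {P : Measure Ω}
  [IsProbabilityMeasure P]

/-- Pseudo-maximisation: the Gaussian mixture of the exponential supermartingales of a
vector-valued martingale with conditionally sub-Gaussian increments. -/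
lemma lintegral_exp_invQuad_div_sqrt_det_le (ℱ : Filtration ℕ mΩ) (z : ℕ → Ω → n → ℝ)
    (η : ℕ → Ω → ℝ) (T : ℕ) (hz : ∀ s < T, Measurable[ℱ s] (z s))
    (hη : ∀ s < T, Measurable[ℱ (s + 1)] (η s))
    (hsub : ∀ s < T, ∀ᵐ ω ∂(P.trim (ℱ.le s)), ∀ γ : ℝ,
      ∫⁻ ω', ENNReal.ofReal (Real.exp (γ * η s ω')) ∂(condExpKernel P (ℱ s) ω) ≤
        ENNReal.ofReal (Real.exp (γ ^ 2 / 2))) (t : ℕ) (ht : t ≤ T) :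
    ∫⁻ ω, ENNReal.ofReal (Real.exp (invQuad (regGram (fun s => z s ω) (Finset.range t))
        (∑ s ∈ Finset.range t, η s ω • z s ω) / 2) /
          √(regGram (fun s => z s ω) (Finset.range t)).det) ∂P ≤ 1 := by
  induction t with
  | zero => simp [regGram_empty, invQuad]
  | succ t ih =>
    have htT : t < T := ht
    set V : Ω → Matrix n n ℝ := fun ω => regGram (fun s => z s ω) (Finset.range t) with hV
    set S : Ω → n → ℝ := fun ω => ∑ s ∈ Finset.range t, η s ω • z s ω with hS
    have hVpos : ∀ ω, (V ω).PosDef := fun ω => posDef_regGram _ _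
    set Z : Ω → ℝ := fun ω => Real.exp (invQuad (V ω) (S ω) / 2) / √(V ω).det with hZ
    set b : Ω → ℝ := fun ω => z t ω ⬝ᵥ (V ω)⁻¹ *ᵥ S ω with hb
    set m : Ω → ℝ := fun ω => invQuad (V ω) (z t ω) with hm
    have hm0 : ∀ ω, 0 ≤ m ω := fun ω => invQuad_nonneg (hVpos ω) _
    have hzt : ∀ s ≤ t, Measurable[ℱ t] (z s) := fun s hs =>
      (hz s (hs.trans_lt htT)).mono (ℱ.mono hs) le_rfl
    have hηt : ∀ s < t, Measurable[ℱ t] (η s) := fun s hs =>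
      (hη s (hs.trans htT)).mono (ℱ.mono hs) le_rfl
    have hVm : ∀ i j, Measurable[ℱ t] fun ω => V ω i j :=
      @measurable_regGram_apply Ω (ℱ t) n _ z _ fun s hs => hzt s (Finset.mem_range.1 hs).le
    have hSm : Measurable[ℱ t] S := by
      refine Finset.measurable_sum _ fun s hs => ?_
      exact Measurable.smul (hηt s (Finset.mem_range.1 hs)) (hzt s (Finset.mem_range.1 hs).le)
    have hZm : Measurable[ℱ t] Z :=
      ((@measurable_dotProduct_inv_mulVec Ω (ℱ t) n _ _ V S S hVm hSm hSm).div_const 2).exp.div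
        (@measurable_det Ω (ℱ t) n _ _ V hVm).sqrt
    have hbm : Measurable[ℱ t] b :=
      @measurable_dotProduct_inv_mulVec Ω (ℱ t) n _ _ V (z t) S hVm (hzt t le_rfl) hSm
    have hmm : Measurable[ℱ t] m :=
      @measurable_dotProduct_inv_mulVec Ω (ℱ t) n _ _ V (z t) (z t) hVm (hzt t le_rfl) (hzt t le_rfl)
    have hηm : Measurable (η t) := (hη t htT).mono (ℱ.le _) le_rfl
    -- By Sherman-Morrison and the determinant lemma, the ratio of successive terms is the scalar
    -- mixture of the exponential factors with `γ ∼ N(b, m)`. Mixing one round at a time replaces a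
    -- `d`-dimensional Gaussian integral.
    set h : ℝ → ℝ → ℝ → ℝ := fun m b y =>
      (√(1 + m))⁻¹ * Real.exp ((2 * y * b + y ^ 2 * m - b ^ 2) / (2 * (1 + m))) with hh
    have hstep : ∀ ω, Real.exp (invQuad (regGram (fun s => z s ω) (Finset.range (t + 1)))
        (∑ s ∈ Finset.range (t + 1), η s ω • z s ω) / 2) /
          √(regGram (fun s => z s ω) (Finset.range (t + 1))).det =
        Z ω * h (m ω) (b ω) (η t ω) := by
      intro ω
      have h1m : 0 < 1 + m ω := by linarith [hm0 ω]
      rw [Finset.sum_range_succ, regGram_range_succ]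
      change Real.exp (invQuad (V ω + _) (S ω + _) / 2) / √(V ω + _).det = _
      rw [invQuad_add_vecMulVec_add_smul (hVpos ω), (hVpos ω).det_add_vecMulVec,
        Real.sqrt_mul (hVpos ω).det_pos.le]
      change Real.exp ((invQuad (V ω) (S ω) + (2 * η t ω * b ω + η t ω ^ 2 * m ω - b ω ^ 2) /
        (1 + m ω)) / 2) / (√(V ω).det * √(1 + m ω)) = _
      rw [add_div, Real.exp_add, div_div, mul_comm (1 + m ω) 2]
      simp only [hZ, hh]
      field_simp
    simp_rw [hstep]
    set g : Ω × Ω → ℝ≥0∞ := fun p =>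
      ENNReal.ofReal (Z p.1) * ENNReal.ofReal (h (m p.1) (b p.1) (η t p.2)) with hg
    have hg_meas : Measurable[(ℱ t).prod mΩ] g := by
      have hf : @Measurable _ _ ((ℱ t).prod mΩ) (ℱ t) (Prod.fst : Ω × Ω → Ω) :=
        @measurable_fst Ω Ω (ℱ t) mΩ
      have hs : @Measurable _ _ ((ℱ t).prod mΩ) mΩ (Prod.snd : Ω × Ω → Ω) :=
        @measurable_snd Ω Ω (ℱ t) mΩ
      have h1 := hZm.comp hf
      have h2 := hmm.comp hf
      have h3 := hbm.comp hf
      have h4 := hηm.comp hs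
      refine h1.ennreal_ofReal.mul (Measurable.ennreal_ofReal ?_)
      refine (measurable_const.add h2).sqrt.inv.mul (Measurable.exp ?_)
      exact ((((measurable_const.mul h4).mul h3).add ((h4.pow_const 2).mul h2)).sub
        (h3.pow_const 2)).div (measurable_const.mul (measurable_const.add h2))
    calc ∫⁻ ω, ENNReal.ofReal (Z ω * h (m ω) (b ω) (η t ω)) ∂P
        = ∫⁻ ω, g (ω, ω) ∂P := lintegral_congr fun ω => ENNReal.ofReal_mul (by positivity)
      _ = ∫⁻ ω, ∫⁻ ω', g (ω, ω') ∂(condExpKernel P (ℱ t) ω) ∂(P.trim (ℱ.le t)) :=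
          lintegral_diag_eq_lintegral_condExpKernel (ℱ.le t) hg_meas
      _ ≤ ∫⁻ ω, ENNReal.ofReal (Z ω) ∂(P.trim (ℱ.le t)) := by
          refine lintegral_mono_ae ?_
          filter_upwards [hsub t htT] with ω hω
          simp only [hg]
          rw [lintegral_const_mul _ (by fun_prop)]
          exact mul_le_of_le_one_right' (lintegral_exp_quadratic_le _ hηm hω (b ω) (hm0 ω))
      _ = ∫⁻ ω, ENNReal.ofReal (Z ω) ∂P := lintegral_trim (ℱ.le t) hZm.ennreal_ofReal
      _ ≤ 1 := ih htT.le

/-- The self-normalised deviation inequality at a fixed time. -/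
lemma measure_invQuad_gt_le (ℱ : Filtration ℕ mΩ) (z : ℕ → Ω → n → ℝ)
    (η : ℕ → Ω → ℝ) (T : ℕ) (hz : ∀ s < T, Measurable[ℱ s] (z s))
    (hη : ∀ s < T, Measurable[ℱ (s + 1)] (η s))
    (hsub : ∀ s < T, ∀ᵐ ω ∂(P.trim (ℱ.le s)), ∀ γ : ℝ,
      ∫⁻ ω', ENNReal.ofReal (Real.exp (γ * η s ω')) ∂(condExpKernel P (ℱ s) ω) ≤
        ENNReal.ofReal (Real.exp (γ ^ 2 / 2)))
    (hz1 : ∀ s < T, ∀ ω, z s ω ⬝ᵥ z s ω ≤ 1) {ε : ℝ} (hε : 0 < ε) :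
    P {ω | Fintype.card n * Real.log (1 + T) + 2 * Real.log (1 / ε) <
      invQuad (regGram (fun s => z s ω) (Finset.range T)) (∑ s ∈ Finset.range T, η s ω • z s ω)} ≤
      ENNReal.ofReal ε := by
  set Z : Ω → ℝ := fun ω => Real.exp (invQuad (regGram (fun s => z s ω) (Finset.range T))
        (∑ s ∈ Finset.range T, η s ω • z s ω) / 2) /
          √(regGram (fun s => z s ω) (Finset.range T)).det with hZ
  have hI := lintegral_exp_invQuad_div_sqrt_det_le ℱ z η T hz hη hsub T le_rfl
  change ∫⁻ ω, ENNReal.ofReal (Z ω) ∂P ≤ 1 at hI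
  have hVm : ∀ i j, Measurable fun ω => regGram (fun s => z s ω) (Finset.range T) i j :=
    measurable_regGram_apply fun s hs =>
      (hz s (Finset.mem_range.1 hs)).mono (ℱ.le _) le_rfl
  have hSm : Measurable fun ω => ∑ s ∈ Finset.range T, η s ω • z s ω := by
    refine Finset.measurable_sum _ fun s hs => ?_
    exact Measurable.smul ((hη s (Finset.mem_range.1 hs)).mono (ℱ.le _) le_rfl)
      ((hz s (Finset.mem_range.1 hs)).mono (ℱ.le _) le_rfl)
  have hZm : Measurable Z := ((measurable_dotProduct_inv_mulVec hVm hSm hSm).div_const 2).exp.div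
        (measurable_det hVm).sqrt
  have hmarkov := mul_meas_ge_le_lintegral (μ := P) hZm.ennreal_ofReal (ENNReal.ofReal (1 / ε))
  have h1 : P {ω | ENNReal.ofReal (1 / ε) ≤ ENNReal.ofReal (Z ω)} ≤ ENNReal.ofReal ε := by
    have h2 := hmarkov.trans hI
    calc _ = ENNReal.ofReal ε * (ENNReal.ofReal (1 / ε) *
          P {ω | ENNReal.ofReal (1 / ε) ≤ ENNReal.ofReal (Z ω)}) := by
          rw [← mul_assoc, ← ENNReal.ofReal_mul hε.le, mul_one_div_cancel hε.ne',
            ENNReal.ofReal_one, one_mul]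
      _ ≤ ENNReal.ofReal ε * 1 := by gcongr
      _ = _ := mul_one _
  refine (measure_mono fun ω hω => ?_).trans h1
  refine ENNReal.ofReal_le_ofReal ?_
  rw [Set.mem_ofPred_eq] at hω
  have hdet := det_regGram_le (fun s => z s ω) (Finset.range T) fun s hs =>
    hz1 s (Finset.mem_range.1 hs) ω
  have hpos := det_regGram_pos (fun s => z s ω) (Finset.range T)
  have hlog := Real.log_le_log hpos hdet
  rw [Real.log_pow, Finset.card_range] at hlog
  rw [hZ, le_div_iff₀ (Real.sqrt_pos.2 hpos), ← Real.log_le_iff_le_exp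
    (mul_pos (by positivity) (Real.sqrt_pos.2 hpos)), Real.log_mul (by positivity)
    (Real.sqrt_pos.2 hpos).ne', Real.log_sqrt hpos.le]
  linarith

end SelfNormalized

/-! ### Concentration of the number of outstanding rewards -/

section Delays

open scoped ENNReal

lemma measurable_one_add_indicator {Ω : Type*} {m : MeasurableSpace Ω} {A : Set Ω}
    (hA : MeasurableSet[m] A) :
    Measurable[m] fun ω => 1 + A.indicator (1 : Ω → ℝ≥0∞) ω :=
  (measurable_one.indicator hA).const_add 1

variable {Ω : Type*} [mΩ : MeasurableSpace Ω] {P : Measure Ω} [IsProbabilityMeasure P]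

/-- The product is 2 to the number of events that occur, so this is the moment generating function
at `log 2`; it factorises because each event is independent of the past. -/
lemma lintegral_prod_one_add_indicator_eq (ℱ : Filtration ℕ mΩ) (A : ℕ → Set Ω) (T : ℕ)
    (hA : ∀ s < T, MeasurableSet[ℱ (s + 1)] (A s))
    (hind : ∀ s < T, Indep (MeasurableSpace.generateFrom {A s}) (ℱ s) P) (t : ℕ) (ht : t ≤ T) :
    ∫⁻ ω, ∏ s ∈ Finset.range t, (1 + (A s).indicator (1 : Ω → ℝ≥0∞) ω) ∂P =
      ∏ s ∈ Finset.range t, (1 + P (A s)) := by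
  induction t with
  | zero => simp
  | succ t ih =>
    have htT : t < T := ht
    have hAt : MeasurableSet (A t) := (ℱ.le _) _ (hA t htT)
    simp only [Finset.prod_range_succ]
    rw [lintegral_mul_eq_lintegral_mul_lintegral_of_independent_measurableSpace
      (ℱ.le t) (MeasurableSpace.generateFrom_le (by simpa using hAt)) (hind t htT).symm, ih htT.le,
      lintegral_add_left measurable_const]
    · simp [lintegral_indicator_one hAt]
    · refine Finset.measurable_prod _ fun s hs => ?_
      have hs' := Finset.mem_range.1 hs
      exact measurable_one_add_indicator (ℱ.mono (Nat.succ_le_of_lt hs') _ (hA s (hs'.trans htT)))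
    · exact measurable_one_add_indicator (MeasurableSpace.measurableSet_generateFrom rfl)

/-- A delay `k` can leave at most the last `k` rounds before `t` pending, so summing the tails gives
at most the mean. -/
lemma sum_toMeasure_le_ofReal_meanDelay (f : PMF ℕ)
    (hf : Integrable (fun n : ℕ => (n : ℝ)) f.toMeasure) (t : ℕ) :
    ∑ s ∈ Finset.range t, f.toMeasure {k | t ≤ s + k} ≤ ENNReal.ofReal (meanDelay f) := by
  rw [meanDelay, ofReal_integral_eq_lintegral_ofReal hf (ae_of_all _ fun _ => Nat.cast_nonneg _)]
  calc _ = ∑ s ∈ Finset.range t, ∫⁻ k, {k | t ≤ s + k}.indicator 1 k ∂f.toMeasure := by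
        simp_rw [lintegral_indicator_one (DiscreteMeasurableSpace.forall_measurableSet _)]
    _ = ∫⁻ k, ∑ s ∈ Finset.range t, {k | t ≤ s + k}.indicator 1 k ∂f.toMeasure :=
        (lintegral_finsetSum _ fun _ _ => Measurable.of_discrete).symm
    _ ≤ _ := by
      refine lintegral_mono fun k => ?_
      simp only [Set.indicator_apply, Set.mem_ofPred_eq, Pi.one_apply, Finset.sum_boole,
        ENNReal.ofReal_natCast]
      have h : {s ∈ Finset.range t | t ≤ s + k} ⊆ Finset.Ico (t - k) t := by
        intro s hs
        simp only [Finset.mem_filter, Finset.mem_range] at hs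
        simp only [Finset.mem_Ico]; omega
      have := Finset.card_le_card h
      rw [Nat.card_Ico] at this
      exact_mod_cast this.trans (by omega)

lemma measure_card_gt_le (ℱ : Filtration ℕ mΩ) (τ : ℕ → Ω → ℕ) (f : PMF ℕ)
    (hf : Integrable (fun n : ℕ => (n : ℝ)) f.toMeasure) (T : ℕ)
    (hτ : ∀ s < T, Measurable[ℱ (s + 1)] (τ s)) (hlaw : ∀ s < T, P.map (τ s) = f.toMeasure)
    (hind : ∀ s < T, Indep (MeasurableSpace.comap (τ s) ⊤) (ℱ s) P) {ε : ℝ} (hε : 0 < ε) :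
    P {ω | 2 * (meanDelay f + Real.log (1 / ε)) <
      (({s ∈ Finset.range T | T ≤ s + τ s ω}.card : ℕ) : ℝ)} ≤ ENNReal.ofReal ε := by
  set A : ℕ → Set Ω := fun s => {ω | T ≤ s + τ s ω} with hAdef
  have hpre : ∀ s, A s = τ s ⁻¹' {k | T ≤ s + k} := fun s => rfl
  have hA : ∀ s < T, MeasurableSet[ℱ (s + 1)] (A s) := fun s hs =>
    hτ s hs (DiscreteMeasurableSpace.forall_measurableSet {k | T ≤ s + k})
  have hτ' : ∀ s < T, Measurable (τ s) := fun s hs => (hτ s hs).mono (ℱ.le _) le_rfl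
  have hPA : ∀ s < T, P (A s) = f.toMeasure {k | T ≤ s + k} := fun s hs => by
    rw [← hlaw s hs, Measure.map_apply (hτ' s hs) (DiscreteMeasurableSpace.forall_measurableSet _),
      hpre]
  have hindA : ∀ s < T, Indep (MeasurableSpace.generateFrom {A s}) (ℱ s) P := fun s hs =>
    indep_of_indep_of_le_left (hind s hs) (MeasurableSpace.generateFrom_le (by
      simpa using ⟨{k | T ≤ s + k}, trivial, rfl⟩))
  set Z : Ω → ℝ≥0∞ := fun ω => ∏ s ∈ Finset.range T, (1 + (A s).indicator (1 : Ω → ℝ≥0∞) ω) with hZ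
  have hZm : Measurable Z := Finset.measurable_prod _ fun s hs =>
    measurable_one_add_indicator ((ℱ.le _) _ (hA s (Finset.mem_range.1 hs)))
  have hμ : 0 ≤ meanDelay f := integral_nonneg fun _ => Nat.cast_nonneg _
  have hint : ∫⁻ ω, Z ω ∂P ≤ ENNReal.ofReal (Real.exp (meanDelay f)) := by
    rw [hZ, lintegral_prod_one_add_indicator_eq ℱ A T hA hindA T le_rfl]
    have h1 : ∀ s ∈ Finset.range T, 1 + P (A s) ≤
        ENNReal.ofReal (Real.exp (P.real (A s))) := by
      intro s _
      rw [← ofReal_measureReal, ← ENNReal.ofReal_one, ← ENNReal.ofReal_add zero_le_one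
        measureReal_nonneg, add_comm]
      exact ENNReal.ofReal_le_ofReal (Real.add_one_le_exp _)
    refine (Finset.prod_le_prod' h1).trans ?_
    rw [← ENNReal.ofReal_prod_of_nonneg fun _ _ => (Real.exp_pos _).le, ← Real.exp_sum]
    refine ENNReal.ofReal_le_ofReal (Real.exp_le_exp.2 ?_)
    rw [← ENNReal.ofReal_le_ofReal_iff hμ,
      ENNReal.ofReal_sum_of_nonneg fun _ _ => measureReal_nonneg]
    refine le_trans (le_of_eq (Finset.sum_congr rfl fun s hs => ?_))
      (sum_toMeasure_le_ofReal_meanDelay f hf T)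
    rw [ofReal_measureReal, hPA s (Finset.mem_range.1 hs)]
  have hmarkov := mul_meas_ge_le_lintegral (μ := P) hZm
    (ENNReal.ofReal (Real.exp (meanDelay f) * (1 / ε)))
  have h1 : P {ω | ENNReal.ofReal (Real.exp (meanDelay f) * (1 / ε)) ≤ Z ω} ≤ ENNReal.ofReal ε := by
    have hc : 0 ≤ ε * Real.exp (-meanDelay f) := by positivity
    calc _ = ENNReal.ofReal (ε * Real.exp (-meanDelay f)) *
          (ENNReal.ofReal (Real.exp (meanDelay f) * (1 / ε)) *
          P {ω | ENNReal.ofReal (Real.exp (meanDelay f) * (1 / ε)) ≤ Z ω}) := by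
          rw [← mul_assoc, ← ENNReal.ofReal_mul hc]
          have : ε * Real.exp (-meanDelay f) * (Real.exp (meanDelay f) * (1 / ε)) = 1 := by
            rw [Real.exp_neg]; field_simp
          rw [this, ENNReal.ofReal_one, one_mul]
      _ ≤ ENNReal.ofReal (ε * Real.exp (-meanDelay f)) *
          ENNReal.ofReal (Real.exp (meanDelay f)) := by gcongr; exact hmarkov.trans hint
      _ = _ := by
        rw [← ENNReal.ofReal_mul hc, mul_assoc, ← Real.exp_add]; simp
  refine (measure_mono fun ω hω => ?_).trans h1
  rw [Set.mem_ofPred_eq] at hω ⊢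
  have hZω : Z ω = ENNReal.ofReal (2 ^ ({s ∈ Finset.range T | T ≤ s + τ s ω}.card)) := by
    simp only [hZ, Set.indicator_apply, hAdef, Set.mem_ofPred_eq, Pi.one_apply]
    rw [Finset.card_filter, ← Finset.prod_pow_eq_pow_sum, ENNReal.ofReal_prod_of_nonneg]
    · refine Finset.prod_congr rfl fun s _ => ?_
      split_ifs <;> norm_num
    · intro _ _; positivity
  rw [hZω]
  refine ENNReal.ofReal_le_ofReal ?_
  rw [← Real.log_le_log_iff (by positivity) (by positivity), Real.log_mul (by positivity)
    (by positivity), Real.log_exp, Real.log_pow]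
  -- The factor 2 in the threshold suffices because `log 2 > 1 / 2`.
  have := Real.log_two_gt_d9
  have h0 : (0 : ℝ) ≤ ({s ∈ Finset.range T | T ≤ s + τ s ω}.card : ℕ) := Nat.cast_nonneg _
  nlinarith

end Delays

/-! ### Gaussian tails from below and above -/

section Gaussian

open scoped ENNReal

lemma le_gaussianReal_Ici_three_halves :
    ENNReal.ofReal (1 / 64) ≤ gaussianReal 0 1 (Set.Ici (3 / 2)) := by
  have hsub : Set.Icc (3 / 2 : ℝ) 2 ⊆ Set.Ici (3 / 2) := fun x hx => hx.1
  refine le_trans ?_ (measure_mono hsub)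
  rw [gaussianReal_apply _ one_ne_zero]
  -- The density is at least `1 / 32` on an interval of length `1 / 2`, hence the constant `1 / 64`.
  have hlow : ∀ x ∈ Set.Icc (3 / 2 : ℝ) 2, ENNReal.ofReal (1 / 32) ≤ gaussianPDF 0 1 x := by
    intro x hx
    refine ENNReal.ofReal_le_ofReal ?_
    simp only [gaussianPDFReal, NNReal.coe_one, mul_one, sub_zero]
    have h1 : √(2 * Real.pi) ≤ 2.6 := by
      rw [Real.sqrt_le_left (by norm_num)]
      have := Real.pi_lt_d2
      norm_num at this ⊢; linarith
    have h2 : Real.exp (-2) ≤ Real.exp (-x ^ 2 / 2) := by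
      refine Real.exp_le_exp.2 ?_
      nlinarith [hx.1, hx.2]
    have h3 : 1 / 9 ≤ Real.exp (-2) := by
      rw [Real.exp_neg, one_div]
      refine inv_anti₀ (Real.exp_pos _) ?_
      have h := Real.exp_one_lt_d9
      have : Real.exp 2 = Real.exp 1 * Real.exp 1 := by rw [← Real.exp_add]; norm_num
      rw [this]
      nlinarith [Real.exp_pos 1]
    have h4 : 1 / 2.6 ≤ (√(2 * Real.pi))⁻¹ := by
      rw [one_div]
      exact inv_anti₀ (by positivity) h1
    calc (1 / 32 : ℝ) ≤ 1 / 2.6 * (1 / 9) := by norm_num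
      _ ≤ _ := mul_le_mul h4 (h3.trans h2) (by norm_num) (by positivity)
  calc ENNReal.ofReal (1 / 64) = ENNReal.ofReal (1 / 32) * volume (Set.Icc (3 / 2 : ℝ) 2) := by
        rw [Real.volume_Icc, ← ENNReal.ofReal_mul (by norm_num)]; norm_num
    _ = ∫⁻ _ in Set.Icc (3 / 2 : ℝ) 2, ENNReal.ofReal (1 / 32) := (setLIntegral_const _ _).symm
    _ ≤ _ := setLIntegral_mono (measurable_gaussianPDF _ _) hlow

lemma gaussianReal_abs_gt_le {r : ℝ} (hr : 0 ≤ r) :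
    gaussianReal 0 1 {x | r < |x|} ≤ ENNReal.ofReal (2 * Real.exp (-(r ^ 2 / 2))) := by
  have hint : ∀ t : ℝ, Integrable (fun x => Real.exp (t * id x)) (gaussianReal 0 1) := fun t =>
    integrable_exp_mul_gaussianReal t
  have h1 : gaussianReal 0 1 {x | r ≤ x} ≤ ENNReal.ofReal (Real.exp (-(r ^ 2 / 2))) := by
    have h := measure_ge_le_exp_mul_mgf (μ := gaussianReal 0 1) (X := id) (t := r) r hr (hint r)
    rw [mgf_id_gaussianReal, ← Real.exp_add] at h
    rw [← ofReal_measureReal]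
    refine ENNReal.ofReal_le_ofReal (h.trans (Real.exp_le_exp.2 ?_))
    simp only [NNReal.coe_one]; linarith
  have h2 : gaussianReal 0 1 {x | x ≤ -r} ≤ ENNReal.ofReal (Real.exp (-(r ^ 2 / 2))) := by
    have h := measure_le_le_exp_mul_mgf (μ := gaussianReal 0 1) (X := id) (t := -r) (-r) (by linarith)
      (hint (-r))
    rw [mgf_id_gaussianReal, ← Real.exp_add] at h
    rw [← ofReal_measureReal]
    refine ENNReal.ofReal_le_ofReal (h.trans (Real.exp_le_exp.2 ?_))
    simp only [NNReal.coe_one]; linarith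
  calc _ ≤ gaussianReal 0 1 ({x | r ≤ x} ∪ {x | x ≤ -r}) := by
        refine measure_mono fun x hx => ?_
        rcases lt_abs.1 (show r < |x| from hx) with h | h
        · exact Or.inl h.le
        · exact Or.inr (by change x ≤ -r; linarith)
    _ ≤ _ := measure_union_le _ _
    _ ≤ _ := add_le_add h1 h2
    _ = _ := by rw [← ENNReal.ofReal_add (by positivity) (by positivity)]; ring_nf

variable {E : Type*} [NormedAddCommGroup E] [InnerProductSpace ℝ E] [FiniteDimensional ℝ E]
  [MeasurableSpace E] [BorelSpace E]

lemma map_inner_stdGaussian {v : E} (hv : ‖v‖ = 1) :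
    (stdGaussian E).map (fun z => inner ℝ v z) = gaussianReal 0 1 := by
  have h := IsGaussian.map_eq_gaussianReal (μ := stdGaussian E) (innerSL ℝ v)
  rw [variance_dual_stdGaussian, innerSL_apply_norm, hv] at h
  have h2 := integral_strongDual_stdGaussian (innerSL ℝ v)
  rw [h2] at h
  simpa using h

lemma le_stdGaussian_inner_ge (v : E) :
    ENNReal.ofReal (1 / 64) ≤ stdGaussian E {z | 3 / 2 * ‖v‖ ≤ inner ℝ v z} := by
  rcases eq_or_ne v 0 with rfl | hv
  · simp only [norm_zero, mul_zero, inner_zero_left, le_refl, Set.ofPred_true, measure_univ]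
    rw [ENNReal.ofReal_le_one]; norm_num
  · have hv' : 0 < ‖v‖ := norm_pos_iff.2 hv
    have hu : ‖(‖v‖⁻¹ • v)‖ = 1 := by
      rw [norm_smul, norm_inv, norm_norm, inv_mul_cancel₀ hv'.ne']
    have h := le_gaussianReal_Ici_three_halves
    rw [← map_inner_stdGaussian hu, Measure.map_apply (by fun_prop) measurableSet_Ici] at h
    refine h.trans (measure_mono fun z hz => ?_)
    have hz' : 3 / 2 ≤ inner ℝ (‖v‖⁻¹ • v) z := hz
    rw [real_inner_smul_left, ← div_eq_inv_mul, le_div_iff₀ hv'] at hz'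
    exact hz'

lemma stdGaussian_abs_apply_gt_le {n : Type*} [Fintype n] [DecidableEq n] (i : n) {r : ℝ}
    (hr : 0 ≤ r) : stdGaussian (EuclideanSpace ℝ n) {z | r < |z i|} ≤
      ENNReal.ofReal (2 * Real.exp (-(r ^ 2 / 2))) := by
  have hv : ‖(EuclideanSpace.single i 1 : EuclideanSpace ℝ n)‖ = 1 := by simp
  have h := gaussianReal_abs_gt_le hr
  have hm : MeasurableSet {x : ℝ | r < |x|} := measurableSet_lt measurable_const measurable_id.abs
  rw [← map_inner_stdGaussian hv, Measure.map_apply (by fun_prop) hm] at h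
  simpa [EuclideanSpace.inner_single_left] using h

end Gaussian

/-! ### Support functions of decision sets -/

section SupportFunction

variable {E : Type*} [NormedAddCommGroup E] [InnerProductSpace ℝ E]

/-- The support function of a set. -/
def supportFun (D : Set E) (w : E) : ℝ := sSup ((fun a => inner ℝ a w) '' D)

variable {D : Set E}

lemma inner_le_supportFun (hD : ∀ a ∈ D, ‖a‖ ≤ 1) {a : E} (ha : a ∈ D) (w : E) :
    inner ℝ a w ≤ supportFun D w := by
  refine le_csSup ⟨‖w‖, ?_⟩ ⟨a, ha, rfl⟩
  rintro _ ⟨b, hb, rfl⟩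
  exact (real_inner_le_norm b w).trans (mul_le_of_le_one_left (norm_nonneg w) (hD b hb))

lemma supportFun_le (hne : D.Nonempty) {w : E} {c : ℝ} (h : ∀ a ∈ D, inner ℝ a w ≤ c) :
    supportFun D w ≤ c :=
  csSup_le (hne.image _) (by rintro _ ⟨a, ha, rfl⟩; exact h a ha)

lemma continuous_supportFun (hD : ∀ a ∈ D, ‖a‖ ≤ 1) (hne : D.Nonempty) :
    Continuous (supportFun D) := by
  have key : ∀ w w' : E, supportFun D w ≤ supportFun D w' + dist w w' := by
    intro w w'
    refine supportFun_le hne fun a ha => ?_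
    have h1 : inner ℝ a w = inner ℝ a w' + inner ℝ a (w - w') := by rw [inner_sub_right]; ring
    have h2 := (real_inner_le_norm a (w - w')).trans
      (mul_le_of_le_one_left (norm_nonneg _) (hD a ha))
    rw [h1, dist_eq_norm]
    exact add_le_add (inner_le_supportFun hD ha w') h2
  exact (LipschitzWith.of_le_add key).continuous

/-- A decision set need not be closed, so a best action is taken in its compact closure. It may not
be playable, but the support function still dominates it in every direction, which is all that
optimism needs. -/
lemma exists_inner_eq_supportFun [FiniteDimensional ℝ E] (hD : ∀ a ∈ D, ‖a‖ ≤ 1)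
    (hne : D.Nonempty) (θ : E) :
    ∃ a : E, (∀ w, inner ℝ a w ≤ supportFun D w) ∧ supportFun D θ ≤ inner ℝ a θ := by
  have hb : Bornology.IsBounded D := isBounded_iff_forall_norm_le.2 ⟨1, hD⟩
  have hc : IsCompact (closure D) := hb.isCompact_closure
  obtain ⟨a, ha, hmax⟩ := hc.exists_isMaxOn hne.closure
    (f := fun a => inner ℝ a θ) (by fun_prop)
  refine ⟨a, fun w => ?_, supportFun_le hne fun b hb => hmax (subset_closure hb)⟩
  exact closure_minimal (fun b hb => inner_le_supportFun hD hb w)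
    (isClosed_le (f := fun b => inner ℝ b w) (by fun_prop) continuous_const) ha

end SupportFunction

/-! ### Optimism of posterior draws -/

section PosteriorSampling

open scoped ENNReal
open Matrix

lemma real_inner_eq_dotProduct {n : Type*} [Fintype n] (x y : EuclideanSpace ℝ n) :
    inner ℝ x y = x.ofLp ⬝ᵥ y.ofLp := by
  rw [EuclideanSpace.inner_eq_star_dotProduct, star_trivial, dotProduct_comm]

variable {n : Type*} [Fintype n] [DecidableEq n]

lemma sqrt_mul_sqrt_smul_inv {A : Matrix n n ℝ} (hA : A.PosDef) (ν : ℝ) :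
    CFC.sqrt (ν ^ 2 • A⁻¹) * CFC.sqrt (ν ^ 2 • A⁻¹) = ν ^ 2 • A⁻¹ :=
  CFC.sqrt_mul_sqrt_self _ (Matrix.nonneg_iff_posSemidef.2
    (hA.inv.posSemidef.smul (sq_nonneg ν)))

lemma transpose_sqrt (A : Matrix n n ℝ) : (CFC.sqrt A)ᵀ = CFC.sqrt A := by
  have h := (Matrix.nonneg_iff_posSemidef.1 (CFC.sqrt_nonneg A)).isHermitian
  rwa [Matrix.IsHermitian, conjTranspose_eq_transpose_of_trivial] at h

lemma inner_toEuclideanCLM_sqrt (A : Matrix n n ℝ) (a z : EuclideanSpace ℝ n) :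
    inner ℝ a (toEuclideanCLM (𝕜 := ℝ) (CFC.sqrt A) z) =
      inner ℝ (toEuclideanCLM (𝕜 := ℝ) (CFC.sqrt A) a) z := by
  rw [real_inner_eq_dotProduct, real_inner_eq_dotProduct, ofLp_toEuclideanCLM, ofLp_toEuclideanCLM,
    dotProduct_mulVec_comm_of_transpose_eq (transpose_sqrt A), dotProduct_comm]

/-- The left side is the standard deviation of a posterior draw in direction `a`: `ν` times the
scale of the confidence width. -/
lemma norm_toEuclideanCLM_sqrt {A : Matrix n n ℝ} (hA : A.PosDef) {ν : ℝ} (hν : 0 ≤ ν)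
    (a : EuclideanSpace ℝ n) :
    ‖toEuclideanCLM (𝕜 := ℝ) (CFC.sqrt (ν ^ 2 • A⁻¹)) a‖ = ν * √(invQuad A a.ofLp) := by
  have h : ‖toEuclideanCLM (𝕜 := ℝ) (CFC.sqrt (ν ^ 2 • A⁻¹)) a‖ ^ 2 =
      ν ^ 2 * invQuad A a.ofLp := by
    rw [← real_inner_self_eq_norm_sq, ← inner_toEuclideanCLM_sqrt, real_inner_eq_dotProduct,
      ofLp_toEuclideanCLM, ofLp_toEuclideanCLM, mulVec_mulVec, sqrt_mul_sqrt_smul_inv hA,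
      smul_mulVec, dotProduct_smul, smul_eq_mul, invQuad]
  rw [← Real.sqrt_sq (norm_nonneg _), h, Real.sqrt_mul (sq_nonneg ν), Real.sqrt_sq hν]

/-- Anti-concentration: a posterior draw is optimistic with constant probability. -/
lemma le_stdGaussian_supportFun_ge {D : Set (EuclideanSpace ℝ n)} (hD : ∀ a ∈ D, ‖a‖ ≤ 1)
    (hne : D.Nonempty) {A : Matrix n n ℝ} (hA : A.PosDef) {ν : ℝ} (hν : 0 ≤ ν)
    {θ w : EuclideanSpace ℝ n}
    (hconf : ∀ a : EuclideanSpace ℝ n, inner ℝ a (θ - w) ≤ 3 / 2 * (ν * √(invQuad A a.ofLp))) :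
    ENNReal.ofReal (1 / 64) ≤ stdGaussian (EuclideanSpace ℝ n)
      {z | supportFun D θ ≤
        supportFun D (w + toEuclideanCLM (𝕜 := ℝ) (CFC.sqrt (ν ^ 2 • A⁻¹)) z)} := by
  obtain ⟨a, ha, haθ⟩ := exists_inner_eq_supportFun hD hne θ
  refine (le_stdGaussian_inner_ge (toEuclideanCLM (𝕜 := ℝ) (CFC.sqrt (ν ^ 2 • A⁻¹)) a)).trans
    (measure_mono fun z hz => ?_)
  rw [Set.mem_ofPred_eq, norm_toEuclideanCLM_sqrt hA hν] at hz
  rw [Set.mem_ofPred_eq]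
  refine haθ.trans (le_trans ?_ (ha _))
  rw [inner_add_right, inner_toEuclideanCLM_sqrt]
  have h := hconf a
  rw [inner_sub_right] at h
  linarith

lemma pi_stdGaussian_forall_supportFun_lt_le {D : Set (EuclideanSpace ℝ n)}
    (hD : ∀ a ∈ D, ‖a‖ ≤ 1)
    (hne : D.Nonempty) {A : Matrix n n ℝ} (hA : A.PosDef) {ν : ℝ} (hν : 0 ≤ ν)
    {θ w : EuclideanSpace ℝ n}
    (hconf : ∀ a : EuclideanSpace ℝ n, inner ℝ a (θ - w) ≤ 3 / 2 * (ν * √(invQuad A a.ofLp)))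
    (M : ℕ) :
    (Measure.pi fun _ : Fin M => stdGaussian (EuclideanSpace ℝ n)) {z | ∀ m,
      supportFun D (w + toEuclideanCLM (𝕜 := ℝ) (CFC.sqrt (ν ^ 2 • A⁻¹)) (z m)) <
        supportFun D θ} ≤ ENNReal.ofReal ((63 / 64) ^ M) := by
  set S : Set (EuclideanSpace ℝ n) := {z | supportFun D θ ≤
        supportFun D (w + toEuclideanCLM (𝕜 := ℝ) (CFC.sqrt (ν ^ 2 • A⁻¹)) z)} with hS
  have hSm : MeasurableSet S := by
    have := continuous_supportFun hD hne
    exact (isClosed_le continuous_const (by fun_prop)).measurableSet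
  have hset : {z : Fin M → EuclideanSpace ℝ n | ∀ m,
      supportFun D (w + toEuclideanCLM (𝕜 := ℝ) (CFC.sqrt (ν ^ 2 • A⁻¹)) (z m)) <
        supportFun D θ} = Set.univ.pi fun _ => Sᶜ := by
    ext z; simp [hS]
  have h1 : stdGaussian (EuclideanSpace ℝ n) Sᶜ ≤ ENNReal.ofReal (63 / 64) := by
    rw [prob_compl_eq_one_sub hSm]
    calc _ ≤ 1 - ENNReal.ofReal (1 / 64) :=
          tsub_le_tsub_left (le_stdGaussian_supportFun_ge hD hne hA hν hconf) 1
      _ = _ := by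
        rw [← ENNReal.ofReal_one, ← ENNReal.ofReal_sub _ (by norm_num)]; norm_num
  rw [hset, Measure.pi_pi, Finset.prod_const, Finset.card_univ, Fintype.card_fin,
    ENNReal.ofReal_pow (by norm_num)]
  gcongr

/-- The matrix square root is continuous on the positive semidefinite cone, hence Borel there. -/
lemma measurable_sqrt_apply {Ω : Type*} [MeasurableSpace Ω] {A : Ω → Matrix n n ℝ}
    (hpos : ∀ ω, 0 ≤ A ω) (hA : ∀ i j, Measurable fun ω => A ω i j) (i j : n) :
    Measurable fun ω => CFC.sqrt (A ω) i j := by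
  let _ : MeasurableSpace (Matrix n n ℝ) := inferInstanceAs (MeasurableSpace (n → n → ℝ))
  have : BorelSpace (Matrix n n ℝ) := inferInstanceAs (BorelSpace (n → n → ℝ))
  have hAm : Measurable A := measurable_pi_iff.2 fun i => measurable_pi_iff.2 fun j => hA i j
  have hc : Continuous ({a : Matrix n n ℝ | 0 ≤ a}.domRestrict CFC.sqrt) :=
    continuousOn_iff_continuous_domRestrict.1 CFC.continuousOn_sqrt
  have h1 : Measurable fun ω => CFC.sqrt (A ω) := hc.measurable.comp (hAm.subtype_mk (h := hpos))
  exact measurable_pi_iff.1 (measurable_pi_iff.1 h1 i) j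

end PosteriorSampling

/-! ### Fresh randomness and frozen pasts -/

section Independence

open scoped ENNReal

lemma IndepFun.measure_prodMk_mem_le {Ω X Y : Type*} [MeasurableSpace Ω] [MeasurableSpace X]
    [MeasurableSpace Y] {P : Measure Ω} [IsProbabilityMeasure P] {f : Ω → X} {g : Ω → Y}
    (hf : Measurable f) (hg : Measurable g) (hind : IndepFun f g P) {G : Set (X × Y)}
    (hG : MeasurableSet G) {c : ℝ≥0∞} (h : ∀ x, P.map g {y | (x, y) ∈ G} ≤ c) :
    P {ω | (f ω, g ω) ∈ G} ≤ c := by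
  have hlaw := (indepFun_iff_map_prod_eq_prod_map_map hf.aemeasurable hg.aemeasurable).1 hind
  have : IsProbabilityMeasure (P.map f) := Measure.isProbabilityMeasure_map hf.aemeasurable
  have : IsProbabilityMeasure (P.map g) := Measure.isProbabilityMeasure_map hg.aemeasurable
  change P ((fun ω => (f ω, g ω)) ⁻¹' G) ≤ c
  rw [← Measure.map_apply (hf.prodMk hg) hG, hlaw, Measure.prod_apply hG]
  calc _ ≤ ∫⁻ _, c ∂(P.map f) := lintegral_mono fun x => h x
    _ = c := by simp

/-- Fubini for the pair (past, `ζ`): the past is the identity map into `Ω` with the smaller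
σ-algebra `m`, so the event must be measurable for `m.prod mY`. -/
lemma measure_le_of_indep {Ω Y : Type*} {m mΩ : MeasurableSpace Ω} {mY : MeasurableSpace Y}
    {P : Measure Ω} [IsProbabilityMeasure P] (hm : m ≤ mΩ) {ζ : Ω → Y} (hζ : Measurable ζ)
    (hind : Indep (MeasurableSpace.comap ζ mY) m P) {G : Set (Ω × Y)}
    (hG : MeasurableSet[m.prod mY] G) {c : ℝ≥0∞} (h : ∀ ω, P.map ζ {z | (ω, z) ∈ G} ≤ c) :
    P {ω | (ω, ζ ω) ∈ G} ≤ c := by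
  refine @IndepFun.measure_prodMk_mem_le Ω Ω Y mΩ m mY P _ id ζ (measurable_id'' hm) hζ ?_ G hG c h
  refine (@IndepFun_iff_Indep Ω Ω Y mΩ m mY id ζ P).2 ?_
  rw [@MeasurableSpace.comap_id Ω m]
  exact hind.symm

end Independence

/-! ### Joint measurability of the sampling events -/

section Measurability

open Matrix

variable {Ω : Type*} [MeasurableSpace Ω] {n : Type*} [Fintype n]

lemma measurable_ite_add_lt {x : Ω → EuclideanSpace ℝ n} {τ : Ω → ℕ} (hx : Measurable x)
    (hτ : Measurable τ) (s t : ℕ) :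
    Measurable fun ω => if s + τ ω < t then (x ω).ofLp else 0 := by
  refine Measurable.ite ?_ ((PiLp.continuous_ofLp 2 _).measurable.comp hx) measurable_const
  exact hτ (DiscreteMeasurableSpace.forall_measurableSet {k | s + k < t})

/-- A Carathéodory function: continuous in the direction, measurable in `ω`. -/
lemma measurable_supportFun {D : Ω → Set (EuclideanSpace ℝ n)} (hD : ∀ ω, ∀ a ∈ D ω, ‖a‖ ≤ 1)
    (hne : ∀ ω, (D ω).Nonempty) (hm : ∀ w, Measurable fun ω => supportFun (D ω) w) :
    Measurable fun q : Ω × EuclideanSpace ℝ n => supportFun (D q.1) q.2 :=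
  (measurable_uncurry_of_continuous_of_measurable (u := fun w ω => supportFun (D ω) w)
    (fun ω => continuous_supportFun (hD ω) (hne ω)) hm).comp measurable_swap

lemma measurable_sampling_map [DecidableEq n] {A : Ω → Matrix n n ℝ} {S : Ω → n → ℝ}
    (hpos : ∀ ω, (A ω).PosDef) (hA : ∀ i j, Measurable fun ω => A ω i j) (hS : Measurable S)
    (θ : n → ℝ) (ν : ℝ) :
    Measurable fun q : Ω × EuclideanSpace ℝ n =>
      WithLp.toLp 2 (θ - (A q.1)⁻¹ *ᵥ θ + (A q.1)⁻¹ *ᵥ S q.1) +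
        toEuclideanCLM (𝕜 := ℝ) (CFC.sqrt (ν ^ 2 • (A q.1)⁻¹)) q.2 := by
  have hinv := fun i j => measurable_inv_apply hA i j
  have hmul : ∀ (v : Ω → n → ℝ), Measurable v → ∀ i, Measurable fun ω =>
      ((A ω)⁻¹ *ᵥ v ω) i := fun v hv i => by
    simp only [mulVec, dotProduct]
    exact Finset.measurable_sum _ fun j _ => (hinv i j).mul (measurable_pi_iff.1 hv j)
  have hR : ∀ i j, Measurable fun ω => CFC.sqrt (ν ^ 2 • (A ω)⁻¹) i j :=
    measurable_sqrt_apply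
      (fun ω => Matrix.nonneg_iff_posSemidef.2 ((hpos ω).inv.posSemidef.smul (sq_nonneg ν)))
      (fun i j => by
        simpa only [Matrix.smul_apply, smul_eq_mul] using (hinv i j).const_mul (ν ^ 2))
  suffices h : ∀ i, Measurable fun q : Ω × EuclideanSpace ℝ n =>
      (WithLp.toLp 2 (θ - (A q.1)⁻¹ *ᵥ θ + (A q.1)⁻¹ *ᵥ S q.1) +
        toEuclideanCLM (𝕜 := ℝ) (CFC.sqrt (ν ^ 2 • (A q.1)⁻¹)) q.2).ofLp i from
    (PiLp.continuous_toLp 2 _).measurable.comp (measurable_pi_iff.2 h)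
  intro i
  simp only [WithLp.ofLp_add, Pi.add_apply, Pi.sub_apply, ofLp_toEuclideanCLM]
  refine Measurable.add ?_ ?_
  · exact ((measurable_const.sub (hmul _ measurable_const i)).add (hmul _ hS i)).comp measurable_fst
  · simp only [mulVec, dotProduct]
    refine Finset.measurable_sum _ fun j _ => ((hR i j).comp measurable_fst).mul ?_
    exact (measurable_pi_apply j).comp ((PiLp.continuous_ofLp 2 _).measurable.comp measurable_snd)

lemma measurableSet_forall_lt {E : Type*} [MeasurableSpace E] {ι : Type*} [Countable ι]
    {Q : Ω → ℝ} {F : Ω × E → E} {H : Ω × E → ℝ} (hQ : Measurable Q) (hF : Measurable F)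
    (hH : Measurable H) (K : ℝ) (θ : E) :
    MeasurableSet {q : Ω × (ι → E) | Q q.1 ≤ K ∧ ∀ m, H (q.1, F (q.1, q.2 m)) < H (q.1, θ)} := by
  refine (measurableSet_le (hQ.comp measurable_fst) measurable_const).inter ?_
  have : {q : Ω × (ι → E) | ∀ m, H (q.1, F (q.1, q.2 m)) < H (q.1, θ)} =
      ⋂ m, {q | H (q.1, F (q.1, q.2 m)) < H (q.1, θ)} := by ext; simp
  change MeasurableSet {q : Ω × (ι → E) | ∀ m, H (q.1, F (q.1, q.2 m)) < H (q.1, θ)}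
  rw [this]
  refine MeasurableSet.iInter fun m => measurableSet_lt ?_ ?_
  · exact hH.comp (measurable_fst.prodMk
      (hF.comp (measurable_fst.prodMk ((measurable_pi_apply m).comp measurable_snd))))
  · exact hH.comp (measurable_fst.prodMk measurable_const)

end Measurability

/-! ### High-probability events and the regret of one round -/

namespace DelayedLinearBandit

open Matrix
open scoped ENNReal

variable {d T : ℕ} {B : ℝ≥0} {f : PMF ℕ} {Ω : Type*} [mΩ : MeasurableSpace Ω]
  [StandardBorelSpace Ω] {P : Measure Ω} [IsProbabilityMeasure P]
  (𝓑 : DelayedLinearBandit d T B f P)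

/-- The precision matrix with unit regularisation and noise level. -/
def unitPrecision (t : ℕ) (ω : Ω) : Matrix (Fin d) (Fin d) ℝ :=
  regGram (fun s => (𝓑.x s ω).ofLp) (𝓑.observed t ω)

/-- The accumulated observed noise. -/
def noiseSum (t : ℕ) (ω : Ω) : Fin d → ℝ := ∑ s ∈ 𝓑.observed t ω, 𝓑.η s ω • (𝓑.x s ω).ofLp

/-- The action of round `s` if its feedback is available in round `t`, and zero otherwise. -/
def observedAction (t s : ℕ) (ω : Ω) : Fin d → ℝ :=
  if s + 𝓑.τ s ω < t then (𝓑.x s ω).ofLp else 0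

lemma posDef_unitPrecision (t : ℕ) (ω : Ω) : (𝓑.unitPrecision t ω).PosDef := posDef_regGram _ _

lemma precision_one_one (t : ℕ) (ω : Ω) : 𝓑.precision 1 1 t ω = 𝓑.unitPrecision t ω := by
  simp [precision, unitPrecision, regGram, add_comm]

lemma regGram_observedAction (t : ℕ) (ω : Ω) :
    regGram (fun s => 𝓑.observedAction t s ω) (Finset.range t) = 𝓑.unitPrecision t ω := by
  rw [regGram, unitPrecision, regGram, observed, Finset.sum_filter]
  congr 1
  refine Finset.sum_congr rfl fun s _ => ?_
  simp only [observedAction]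
  split_ifs <;> simp

lemma sum_smul_observedAction (c : ℝ) (t : ℕ) (ω : Ω) :
    ∑ s ∈ Finset.range t, (c * 𝓑.η s ω) • 𝓑.observedAction t s ω = c • 𝓑.noiseSum t ω := by
  rw [noiseSum, observed, Finset.sum_filter, Finset.smul_sum]
  refine Finset.sum_congr rfl fun s _ => ?_
  simp only [observedAction]
  split_ifs <;> simp [mul_smul]

lemma posteriorMean_one_one (t : ℕ) (ω : Ω) :
    𝓑.posteriorMean 1 1 t ω = WithLp.toLp 2 (𝓑.θ.ofLp -
      (𝓑.unitPrecision t ω)⁻¹ *ᵥ 𝓑.θ.ofLp + (𝓑.unitPrecision t ω)⁻¹ *ᵥ 𝓑.noiseSum t ω) := by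
  have h : ∑ s ∈ 𝓑.observed t ω, 𝓑.y s ω • (𝓑.x s ω).ofLp =
      𝓑.unitPrecision t ω *ᵥ 𝓑.θ.ofLp - 𝓑.θ.ofLp + 𝓑.noiseSum t ω := by
    rw [unitPrecision, regGram, add_mulVec, one_mulVec, add_sub_cancel_left, sum_mulVec, noiseSum,
      ← Finset.sum_add_distrib]
    refine Finset.sum_congr rfl fun s _ => ?_
    rw [y, add_smul, vecMulVec_mulVec, real_inner_eq_dotProduct]
    congr 1
    ext i
    simp [mul_comm]
  rw [posteriorMean, precision_one_one, h, mulVec_add, mulVec_sub,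
    (𝓑.posDef_unitPrecision t ω).inv_mulVec_mulVec]
  simp

/-- The estimation error is regularisation bias minus noise, both multiplied by the inverse
precision. Cauchy-Schwarz bounds each part; the bias costs `√d` since the precision dominates the
identity and `‖θ‖ ≤ √d`. -/
lemma abs_inner_sub_posteriorMean_le (t : ℕ) (ω : Ω) (a : EuclideanSpace ℝ (Fin d)) :
    |inner ℝ a (𝓑.θ - 𝓑.posteriorMean 1 1 t ω)| ≤
      (√d + √(invQuad (𝓑.unitPrecision t ω) (𝓑.noiseSum t ω))) *
        √(invQuad (𝓑.unitPrecision t ω) a.ofLp) := by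
  have hA := 𝓑.posDef_unitPrecision t ω
  have hcs : ∀ v : Fin d → ℝ, |a.ofLp ⬝ᵥ (𝓑.unitPrecision t ω)⁻¹ *ᵥ v| ≤
      √(invQuad (𝓑.unitPrecision t ω) v) * √(invQuad (𝓑.unitPrecision t ω) a.ofLp) := by
    intro v
    rw [← Real.sqrt_mul (invQuad_nonneg hA _)]
    refine Real.abs_le_sqrt ?_
    rw [mul_comm]
    exact sq_dotProduct_inv_le hA _ _
  have hθ : √(invQuad (𝓑.unitPrecision t ω) 𝓑.θ.ofLp) ≤ √d := by
    refine Real.sqrt_le_sqrt ((invQuad_regGram_le _ _ _).trans ?_)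
    rw [← real_inner_eq_dotProduct, real_inner_self_eq_norm_sq]
    have h := 𝓑.norm_θ_le
    have h2 := pow_le_pow_left₀ (norm_nonneg _) h 2
    rwa [Real.sq_sqrt (Nat.cast_nonneg d)] at h2
  have e : inner ℝ a (𝓑.θ - 𝓑.posteriorMean 1 1 t ω) =
      a.ofLp ⬝ᵥ (𝓑.unitPrecision t ω)⁻¹ *ᵥ 𝓑.θ.ofLp -
        a.ofLp ⬝ᵥ (𝓑.unitPrecision t ω)⁻¹ *ᵥ 𝓑.noiseSum t ω := by
    rw [posteriorMean_one_one, real_inner_eq_dotProduct, WithLp.ofLp_sub]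
    simp only [dotProduct_sub, dotProduct_add]
    ring
  rw [e, add_mul]
  refine (abs_sub _ _).trans (add_le_add ((hcs _).trans ?_) (hcs _))
  gcongr

lemma measurable_τ_pre {s t : ℕ} (hs : s < T) (hst : s < t) : Measurable[𝓑.pre t] (𝓑.τ s) :=
  (𝓑.measurable_τ s hs).mono ((𝓑.del_le_pre s).trans (𝓑.pre.mono hst)) le_rfl

lemma measurable_x_pre {s t : ℕ} (hs : s < T) (hst : s < t) : Measurable[𝓑.pre t] (𝓑.x s) :=
  (𝓑.measurable_x s hs).mono ((𝓑.act_le_del s).trans ((𝓑.del_le_pre s).trans (𝓑.pre.mono hst))) le_rfl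

lemma measurable_η_pre {s t : ℕ} (hs : s < T) (hst : s < t) : Measurable[𝓑.pre t] (𝓑.η s) :=
  (𝓑.measurable_η s hs).mono (𝓑.pre.mono hst) le_rfl

lemma measurable_unitPrecision_apply {t : ℕ} (ht : t < T) (i j : Fin d) :
    Measurable[𝓑.pre t] fun ω => 𝓑.unitPrecision t ω i j := by
  simp_rw [← regGram_observedAction]
  refine @measurable_regGram_apply Ω (𝓑.pre t) (Fin d) _ _ _ (fun s hs => ?_) i j
  have hs' := Finset.mem_range.1 hs
  exact @measurable_ite_add_lt Ω (𝓑.pre t) _ _ _ _ (𝓑.measurable_x_pre (hs'.trans ht) hs')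
    (𝓑.measurable_τ_pre (hs'.trans ht) hs') s t

lemma measurable_noiseSum {t : ℕ} (ht : t < T) : Measurable[𝓑.pre t] (𝓑.noiseSum t) := by
  have h : 𝓑.noiseSum t = fun ω => ∑ s ∈ Finset.range t, 𝓑.η s ω • 𝓑.observedAction t s ω := by
    ext1 ω
    have := 𝓑.sum_smul_observedAction 1 t ω
    simp only [one_mul, one_smul] at this
    exact this.symm
  rw [h]
  refine Finset.measurable_sum _ fun s hs => ?_
  have hs' := Finset.mem_range.1 hs
  exact (𝓑.measurable_η_pre (hs'.trans ht) hs').smul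
    (@measurable_ite_add_lt Ω (𝓑.pre t) _ _ _ _ (𝓑.measurable_x_pre (hs'.trans ht) hs')
      (𝓑.measurable_τ_pre (hs'.trans ht) hs') s t)

/-- The confidence ellipsoid fails with small probability in each round. -/
lemma measure_invQuad_noiseSum_gt_le {t : ℕ} (ht : t < T) {σ : ℝ} (hσ : 0 < σ) (hB : (B : ℝ) ≤ σ)
    {ε : ℝ} (hε : 0 < ε) :
    P {ω | σ ^ 2 * (d * Real.log (1 + T) + 2 * Real.log (1 / ε)) <
      invQuad (𝓑.unitPrecision t ω) (𝓑.noiseSum t ω)} ≤ ENNReal.ofReal ε := by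
  have hdel : ∀ s, 𝓑.pre (s + 1) ≤ 𝓑.del (s + 1) := fun s =>
    (𝓑.pre_le_act _).trans (𝓑.act_le_del _)
  -- The filtration is `del`: it reveals `τ s`, and so the truncated action for this fixed `t`,
  -- before the noise of round `s`. Noise is scaled by `σ⁻¹`; a positive `σ` is used because `B` may
  -- be zero.
  have h := measure_invQuad_gt_le (P := P) 𝓑.del (𝓑.observedAction t) (fun s ω => σ⁻¹ * 𝓑.η s ω) t
    (fun s hs => @measurable_ite_add_lt Ω (𝓑.del s) _ _ _ _
      ((𝓑.measurable_x s (hs.trans ht)).mono (𝓑.act_le_del s) le_rfl)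
      (𝓑.measurable_τ s (hs.trans ht)) s t)
    (fun s hs => Measurable.const_mul
      ((𝓑.measurable_η s (hs.trans ht)).mono (hdel s) le_rfl) _)
    (fun s hs => by
      have h := HasCondSubgaussianMGF.ae_lintegral_exp_le (𝓑.subgaussian_η s (hs.trans ht)) hσ
        (by push_cast; gcongr)
      filter_upwards [h] with ω hω γ
      simpa only [div_eq_inv_mul] using hω γ)
    (fun s hs ω => by
      simp only [observedAction]
      split_ifs
      · rw [← real_inner_eq_dotProduct, real_inner_self_eq_norm_sq]
        have := 𝓑.norm_le_one s (hs.trans ht) ω _ (𝓑.x_mem s (hs.trans ht) ω)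
        exact pow_le_one₀ (norm_nonneg _) this
      · simp) hε
  refine (measure_mono fun ω hω => ?_).trans h
  rw [Set.mem_ofPred_eq] at hω ⊢
  rw [regGram_observedAction, sum_smul_observedAction, invQuad_smul, Fintype.card_fin, inv_pow,
    ← div_eq_inv_mul, lt_div_iff₀ (by positivity)]
  refine lt_of_le_of_lt ?_ hω
  rw [mul_comm]
  have : (t : ℝ) ≤ T := by exact_mod_cast ht.le
  gcongr

variable {M : ℕ} {ν u : ℝ} {ζ : ℕ → Ω → Fin M → EuclideanSpace ℝ (Fin d)}

lemma posteriorDraw_one_one (ν : ℝ) (t : ℕ) (ω : Ω) (z : EuclideanSpace ℝ (Fin d)) :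
    𝓑.posteriorDraw 1 1 ν t ω z = 𝓑.posteriorMean 1 1 t ω +
      toEuclideanCLM (𝕜 := ℝ) (CFC.sqrt (ν ^ 2 • (𝓑.unitPrecision t ω)⁻¹)) z := by
  rw [posteriorDraw, precision_one_one]

lemma measurable_posteriorDraw {t : ℕ} (ht : t < T) (ν : ℝ) :
    @Measurable _ _ ((𝓑.pre t).prod inferInstance) _
      (fun q : Ω × EuclideanSpace ℝ (Fin d) => 𝓑.posteriorDraw 1 1 ν t q.1 q.2) := by
  simp_rw [posteriorDraw_one_one, posteriorMean_one_one]
  exact @measurable_sampling_map Ω (𝓑.pre t) (Fin d) _ _ _ _ (𝓑.posDef_unitPrecision t)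
    (𝓑.measurable_unitPrecision_apply ht) (𝓑.measurable_noiseSum ht) 𝓑.θ.ofLp ν

/-- On the confidence event, all draws of a round are pessimistic with small probability. -/
lemma measure_forall_supportFun_lt_le (hζ : 𝓑.IsDelayedPSLB M 1 1 ν u ζ) (hν : 0 ≤ ν) {t : ℕ}
    (ht : t < T) {K : ℝ} (hK : √d + √K ≤ 3 / 2 * ν) :
    P {ω | invQuad (𝓑.unitPrecision t ω) (𝓑.noiseSum t ω) ≤ K ∧
      ∀ m, supportFun (𝓑.D t ω) (𝓑.posteriorDraw 1 1 ν t ω (ζ t ω m)) <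
        supportFun (𝓑.D t ω) 𝓑.θ} ≤ ENNReal.ofReal ((63 / 64) ^ M) := by
  set G : Set (Ω × (Fin M → EuclideanSpace ℝ (Fin d))) :=
    {q | invQuad (𝓑.unitPrecision t q.1) (𝓑.noiseSum t q.1) ≤ K ∧
      ∀ m, supportFun (𝓑.D t q.1) (𝓑.posteriorDraw 1 1 ν t q.1 (q.2 m)) <
        supportFun (𝓑.D t q.1) 𝓑.θ} with hGdef
  have hG : MeasurableSet[(𝓑.pre t).prod inferInstance] G := by
    have hA := 𝓑.measurable_unitPrecision_apply ht
    have hN := 𝓑.measurable_noiseSum ht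
    have hsup := @measurable_supportFun Ω (𝓑.pre t) (Fin d) _ (𝓑.D t) (𝓑.norm_le_one t ht)
      (fun ω => ⟨_, 𝓑.x_mem t ht ω⟩) (𝓑.measurable_D t ht)
    exact @measurableSet_forall_lt Ω (𝓑.pre t) _ _ _ _ _ _ _
      (@measurable_dotProduct_inv_mulVec Ω (𝓑.pre t) _ _ _ _ _ _ hA hN hN)
      (𝓑.measurable_posteriorDraw ht ν) hsup K 𝓑.θ
  refine measure_le_of_indep (𝓑.pre.le t) ((hζ.measurable_ζ t ht).mono (𝓑.act.le t) le_rfl)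
    (hζ.indep_ζ t ht) hG fun ω => ?_
  rw [hζ.law_ζ t ht]
  by_cases hω : invQuad (𝓑.unitPrecision t ω) (𝓑.noiseSum t ω) ≤ K
  · refine (measure_mono fun z hz => ?_).trans
      (pi_stdGaussian_forall_supportFun_lt_le (D := 𝓑.D t ω) (θ := 𝓑.θ)
        (w := 𝓑.posteriorMean 1 1 t ω) (𝓑.norm_le_one t ht ω) ⟨_, 𝓑.x_mem t ht ω⟩
        (𝓑.posDef_unitPrecision t ω) hν (fun a => ?_) M)
    · intro m
      have := hz.2 m
      rwa [posteriorDraw_one_one] at this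
    · refine (le_abs_self _).trans ((𝓑.abs_inner_sub_posteriorMean_le t ω a).trans ?_)
      rw [← mul_assoc]
      refine mul_le_mul_of_nonneg_right (le_trans ?_ hK) (Real.sqrt_nonneg _)
      gcongr
  -- Off the confidence event the section is empty, so the bound holds for every frozen `ω`.
  · have : {z | (ω, z) ∈ G} = ∅ := by
      ext z; simp [hGdef, hω]
    rw [this, measure_empty]
    exact zero_le

lemma measure_exists_abs_apply_gt_le (hζ : 𝓑.IsDelayedPSLB M 1 1 ν u ζ) {t : ℕ} (ht : t < T)
    {r : ℝ} (hr : 0 ≤ r) :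
    P {ω | ∃ m i, r < |ζ t ω m i|} ≤ ENNReal.ofReal (M * d * (2 * Real.exp (-(r ^ 2 / 2)))) := by
  have hζm : Measurable (ζ t) := (hζ.measurable_ζ t ht).mono (𝓑.act.le t) le_rfl
  have h1 : ∀ m i, P {ω | r < |ζ t ω m i|} ≤ ENNReal.ofReal (2 * Real.exp (-(r ^ 2 / 2))) := by
    intro m i
    have hS : MeasurableSet {z : EuclideanSpace ℝ (Fin d) | r < |z i|} :=
      (isOpen_lt continuous_const (by fun_prop)).measurableSet
    have hmp := measurePreserving_eval
      (fun _ : Fin M => stdGaussian (EuclideanSpace ℝ (Fin d))) m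
    have h2 : P ((fun ω => ζ t ω m) ⁻¹' {z | r < |z i|}) =
        stdGaussian (EuclideanSpace ℝ (Fin d)) {z | r < |z i|} := by
      rw [← hmp.measure_preimage hS.nullMeasurableSet, ← hζ.law_ζ t ht,
        Measure.map_apply hζm (hmp.measurable hS)]
      rfl
    exact (le_of_eq h2).trans (stdGaussian_abs_apply_gt_le i hr)
  have hset : {ω | ∃ m i, r < |ζ t ω m i|} = ⋃ m, ⋃ i, {ω | r < |ζ t ω m i|} := by
    ext ω; simp
  rw [hset]
  calc _ ≤ ∑ m : Fin M, ∑ i : Fin d, P {ω | r < |ζ t ω m i|} :=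
        (measure_iUnion_fintype_le _ _).trans
          (Finset.sum_le_sum fun m _ => measure_iUnion_fintype_le _ _)
    _ ≤ ∑ m : Fin M, ∑ i : Fin d, ENNReal.ofReal (2 * Real.exp (-(r ^ 2 / 2))) :=
        Finset.sum_le_sum fun m _ => Finset.sum_le_sum fun i _ => h1 m i
    _ = _ := by
        simp only [Finset.sum_const, Finset.card_univ, Fintype.card_fin, nsmul_eq_mul]
        rw [mul_assoc, ENNReal.ofReal_mul (Nat.cast_nonneg M), ENNReal.ofReal_mul (Nat.cast_nonneg d),
          ENNReal.ofReal_natCast, ENNReal.ofReal_natCast]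

lemma range_sdiff_observed (t : ℕ) (ω : Ω) :
    Finset.range t \ 𝓑.observed t ω = {s ∈ Finset.range t | t ≤ s + 𝓑.τ s ω} := by
  ext s; simp only [observed, Finset.mem_sdiff, Finset.mem_filter]; grind

lemma measure_card_unobserved_gt_le
    (hf : Integrable (fun n : ℕ => (n : ℝ)) f.toMeasure) {t : ℕ} (ht : t < T) {ε : ℝ}
    (hε : 0 < ε) :
    P {ω | 2 * (meanDelay f + Real.log (1 / ε)) <
      ((Finset.range t \ 𝓑.observed t ω).card : ℝ)} ≤ ENNReal.ofReal ε := by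
  simp_rw [range_sdiff_observed]
  -- The filtration is now `act`: each delay is independent of `act s` and is known by `act (s +
  -- 1)`.
  refine measure_card_gt_le 𝓑.act 𝓑.τ f hf t (fun s hs => ?_)
    (fun s hs => 𝓑.law_τ s (hs.trans ht)) (fun s hs => 𝓑.indep_τ s (hs.trans ht)) hε
  exact (𝓑.measurable_τ s (hs.trans ht)).mono
    ((𝓑.del_le_pre s).trans (𝓑.pre_le_act (s + 1))) le_rfl

lemma observed_subset_range (t : ℕ) (ω : Ω) : 𝓑.observed t ω ⊆ Finset.range t :=
  Finset.filter_subset _ _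

lemma monotone_observed (ω : Ω) : Monotone fun t => 𝓑.observed t ω := by
  intro t t' h s hs
  simp only [observed, Finset.mem_filter, Finset.mem_range] at hs ⊢
  omega

/-- The regret of a round in which some draw is optimistic. -/
lemma supportFun_sub_inner_le (hζ : 𝓑.IsDelayedPSLB M 1 1 ν u ζ) (hν : 0 ≤ ν) {t : ℕ}
    (ht : t < T) (hu : ∀ ω, ∀ a ∈ 𝓑.D t ω, inner ℝ a 𝓑.θ ≤ u) {K : ℝ} (hK : √d + √K ≤ 3 / 2 * ν)
    {r : ℝ} (hr : 0 ≤ r) {ω : Ω}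
    (hconf : invQuad (𝓑.unitPrecision t ω) (𝓑.noiseSum t ω) ≤ K)
    (hopt : ∃ m, supportFun (𝓑.D t ω) 𝓑.θ ≤
      supportFun (𝓑.D t ω) (𝓑.posteriorDraw 1 1 ν t ω (ζ t ω m)))
    (hnorm : ∀ m i, |ζ t ω m i| ≤ r) :
    supportFun (𝓑.D t ω) 𝓑.θ - inner ℝ (𝓑.x t ω) 𝓑.θ ≤
      ν * (3 / 2 + √d * r) * √(invQuad (𝓑.unitPrecision t ω) (𝓑.x t ω).ofLp) := by
  obtain ⟨m, hm⟩ := hopt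
  have : Nonempty (Fin M) := ⟨m⟩
  have hne : (𝓑.D t ω).Nonempty := ⟨_, 𝓑.x_mem t ht ω⟩
  set w : Fin M → EuclideanSpace ℝ (Fin d) := fun m => 𝓑.posteriorDraw 1 1 ν t ω (ζ t ω m) with hw
  obtain ⟨k, hk⟩ := exists_eq_ciSup_of_finite (f := fun m => inner ℝ (𝓑.x t ω) (w m))
  -- Otherwise some action would beat the played one under draw `m` (approximately, as the supremum
  -- may not be attained). Truncation cannot hide this, because `u` is at least the optimal mean
  -- reward.
  have h1 : supportFun (𝓑.D t ω) 𝓑.θ ≤ inner ℝ (𝓑.x t ω) (w k) := by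
    by_contra! hlt
    obtain ⟨_, ⟨a, ha, rfl⟩, hlta⟩ := exists_lt_of_lt_csSup (hne.image _) (hlt.trans_le hm)
    have hmax := hζ.isMaxOn t ht ω ha
    have h2 : inner ℝ a (w m) ≤ ⨆ m, inner ℝ a (w m) :=
      le_ciSup (f := fun m => inner ℝ a (w m)) (Set.finite_range _).bddAbove m
    have h3 : supportFun (𝓑.D t ω) 𝓑.θ ≤ u := supportFun_le hne (hu ω)
    have h4 : min (⨆ m, inner ℝ a (w m)) u ≤ min (⨆ m, inner ℝ (𝓑.x t ω) (w m)) u := hmax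
    rw [← hk] at h4
    have h5 := h4.trans (min_le_left _ _)
    rcases min_le_iff.1 h5 with h | h
    · exact absurd (hlta.trans_le (h2.trans h)) (lt_irrefl _)
    · exact absurd (hlt.trans_le (h3.trans h)) (lt_irrefl _)
  have hA := 𝓑.posDef_unitPrecision t ω
  -- The overestimate splits into the estimation error and the sampling perturbation.
  have h2 : inner ℝ (𝓑.x t ω) (w k) - inner ℝ (𝓑.x t ω) 𝓑.θ =
      -inner ℝ (𝓑.x t ω) (𝓑.θ - 𝓑.posteriorMean 1 1 t ω) +
      inner ℝ (toEuclideanCLM (𝕜 := ℝ) (CFC.sqrt (ν ^ 2 • (𝓑.unitPrecision t ω)⁻¹)) (𝓑.x t ω))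
        (ζ t ω k) := by
    simp only [hw]
    rw [posteriorDraw_one_one, inner_add_right, inner_sub_right, inner_toEuclideanCLM_sqrt]
    ring
  have h3 := (neg_abs_le _).trans' (neg_le_neg (𝓑.abs_inner_sub_posteriorMean_le t ω (𝓑.x t ω)))
  have h4 := real_inner_le_norm
    (toEuclideanCLM (𝕜 := ℝ) (CFC.sqrt (ν ^ 2 • (𝓑.unitPrecision t ω)⁻¹)) (𝓑.x t ω)) (ζ t ω k)
  rw [norm_toEuclideanCLM_sqrt hA hν] at h4
  have h5 : ‖ζ t ω k‖ ≤ √d * r := by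
    rw [EuclideanSpace.norm_eq, ← Real.sqrt_sq hr, ← Real.sqrt_mul (Nat.cast_nonneg d)]
    refine Real.sqrt_le_sqrt ?_
    calc ∑ i, ‖ζ t ω k i‖ ^ 2 ≤ ∑ _i : Fin d, r ^ 2 := by
          refine Finset.sum_le_sum fun i _ => ?_
          rw [Real.norm_eq_abs]
          exact pow_le_pow_left₀ (abs_nonneg _) (hnorm k i) 2
      _ = d * r ^ 2 := by simp
  have h6 : √d + √(invQuad (𝓑.unitPrecision t ω) (𝓑.noiseSum t ω)) ≤ 3 / 2 * ν :=
    le_trans (by gcongr) hK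
  set q := √(invQuad (𝓑.unitPrecision t ω) (𝓑.x t ω).ofLp)
  have hq : 0 ≤ q := Real.sqrt_nonneg _
  have h7 := mul_le_mul_of_nonneg_right h6 hq
  have h8 := mul_le_mul_of_nonneg_left h5 (mul_nonneg hν hq)
  calc _ ≤ inner ℝ (𝓑.x t ω) (w k) - inner ℝ (𝓑.x t ω) 𝓑.θ := by linarith
    _ ≤ 3 / 2 * ν * q + ν * q * (√d * r) := by rw [h2]; linarith
    _ = _ := by ring

end DelayedLinearBandit

/-! ### Numerical bounds for the parameters -/

section Parameters

variable {d T : ℕ} {δ : ℝ}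

lemma one_le_natCast_div (hT : 1 ≤ T) (hδ : 0 < δ) (hδ1 : δ < 1) : 1 ≤ (T : ℝ) / δ := by
  rw [le_div_iff₀ hδ]
  have : (1 : ℝ) ≤ T := by exact_mod_cast hT
  linarith

lemma one_le_mul_div (hd : 1 ≤ d) (hT : 1 ≤ T) (hδ : 0 < δ) (hδ1 : δ < 1) :
    1 ≤ (d : ℝ) * T / δ := by
  have h1 := one_le_natCast_div hT hδ hδ1
  have h2 : (1 : ℝ) ≤ d := by exact_mod_cast hd
  rw [mul_div_assoc]
  nlinarith

lemma div_le_mul_div (hd : 1 ≤ d) (hT : 1 ≤ T) (hδ : 0 < δ) (hδ1 : δ < 1) :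
    (T : ℝ) / δ ≤ d * T / δ := by
  have h1 := one_le_natCast_div hT hδ hδ1
  have h2 : (1 : ℝ) ≤ d := by exact_mod_cast hd
  rw [mul_div_assoc]
  nlinarith

lemma one_le_pslbLog (hd : 1 ≤ d) (hT : 1 ≤ T) (hδ : 0 < δ) (hδ1 : δ < 1) :
    1 ≤ pslbLog d T δ := by
  have := Real.log_nonneg (one_le_mul_div hd hT hδ hδ1)
  rw [pslbLog]; linarith

lemma log_four_mul_div_le (hd : 1 ≤ d) (hT : 1 ≤ T) (hδ : 0 < δ) (hδ1 : δ < 1) :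
    Real.log (4 * T / δ) ≤ 2 * pslbLog d T δ := by
  have h0 := one_le_natCast_div hT hδ hδ1
  have h1 := Real.log_le_log (by linarith) (div_le_mul_div hd hT hδ hδ1)
  have h2 : Real.log 4 ≤ 2 := by
    have : (4 : ℝ) = 2 ^ 2 := by norm_num
    rw [this, Real.log_pow]
    have := Real.log_two_lt_d9
    push_cast; linarith
  have h3 := one_le_pslbLog hd hT hδ hδ1
  rw [mul_div_assoc, Real.log_mul (by norm_num) (by linarith)]
  have : pslbLog d T δ = 1 + Real.log (d * T / δ) := rfl
  linarith

lemma log_one_add_le (hd : 1 ≤ d) (hT : 1 ≤ T) (hδ : 0 < δ) (hδ1 : δ < 1) :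
    Real.log (1 + T) ≤ pslbLog d T δ := by
  have hT' : (1 : ℝ) ≤ T := by exact_mod_cast hT
  have h1 : (1 : ℝ) + T ≤ 2 * (d * T / δ) := by
    have h2 : (T : ℝ) ≤ T / δ := by rw [le_div_iff₀ hδ]; nlinarith
    have := div_le_mul_div hd hT hδ hδ1
    linarith
  have h2 := Real.log_le_log (by linarith) h1
  rw [Real.log_mul (by norm_num) (by linarith [one_le_mul_div hd hT hδ hδ1])] at h2
  have := Real.log_two_lt_d9
  rw [pslbLog]; linarith

lemma one_div_le_log : (1 / 64 : ℝ) ≤ Real.log (64 / 63) := by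
  have := Real.one_sub_inv_le_log_of_pos (show (0 : ℝ) < 64 / 63 by norm_num)
  norm_num at this ⊢; linarith

lemma pow_pslbDraws_le (hT : 1 ≤ T) (hδ : 0 < δ) :
    (63 / 64 : ℝ) ^ pslbDraws T δ ≤ δ / (4 * T) := by
  have hT' : (1 : ℝ) ≤ T := by exact_mod_cast hT
  have h1 := one_div_le_log
  have h2 : Real.log (4 * T / δ) ≤ pslbDraws T δ * Real.log (64 / 63) := by
    rw [← div_le_iff₀ (by linarith)]
    exact Nat.le_ceil _
  rw [← Real.log_le_log_iff (by positivity) (by positivity), Real.log_pow]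
  have h3 : Real.log (63 / 64) = -Real.log (64 / 63) := by
    rw [← Real.log_inv]; norm_num
  have h4 : Real.log (δ / (4 * T)) = -Real.log (4 * T / δ) := by
    rw [← Real.log_inv, inv_div]
  rw [h3, h4]; linarith

lemma pslbDraws_le (hT : 1 ≤ T) (hδ : 0 < δ) (hδ1 : δ < 1) :
    (pslbDraws T δ : ℝ) ≤ 257 * (T / δ) := by
  have h0 := one_le_natCast_div hT hδ hδ1
  have h1 := one_div_le_log
  have hlog : 0 ≤ Real.log (4 * T / δ) := Real.log_nonneg (by rw [mul_div_assoc]; linarith)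
  have h2 : Real.log (4 * T / δ) ≤ 4 * (T / δ) := by
    have := Real.log_le_sub_one_of_pos (show 0 < 4 * T / δ by rw [mul_div_assoc]; linarith)
    rw [mul_div_assoc] at this ⊢; linarith
  have h3 : Real.log (4 * T / δ) / Real.log (64 / 63) ≤ 64 * Real.log (4 * T / δ) := by
    rw [div_le_iff₀ (by linarith)]; nlinarith
  have h4 := (Nat.ceil_lt_add_one (show 0 ≤ Real.log (4 * T / δ) / Real.log (64 / 63) from
    div_nonneg hlog (by linarith))).le
  change (pslbDraws T δ : ℝ) ≤ _ at h4
  linarith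

lemma pslbDraws_pos (hT : 1 ≤ T) (hδ : 0 < δ) (hδ1 : δ < 1) : 0 < pslbDraws T δ := by
  have h0 := one_le_natCast_div hT hδ hδ1
  refine Nat.ceil_pos.2 (div_pos (Real.log_pos ?_) (by linarith [one_div_le_log]))
  rw [mul_div_assoc]; linarith

/-- A bound that all coordinates of all normal vectors respect with high probability. -/
def normalBound (d T : ℕ) (δ : ℝ) : ℝ := √(2 * Real.log (8 * pslbDraws T δ * d * T / δ))

lemma one_le_normalBound_arg (hd : 1 ≤ d) (hT : 1 ≤ T) (hδ : 0 < δ) (hδ1 : δ < 1) :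
    1 ≤ 8 * (pslbDraws T δ : ℝ) * d * T / δ := by
  have h0 := one_le_mul_div hd hT hδ hδ1
  have h1 : (1 : ℝ) ≤ pslbDraws T δ := by exact_mod_cast pslbDraws_pos hT hδ hδ1
  have : 8 * (pslbDraws T δ : ℝ) * d * T / δ = 8 * pslbDraws T δ * (d * T / δ) := by ring
  rw [this]; nlinarith

lemma normalBound_le (hd : 1 ≤ d) (hT : 1 ≤ T) (hδ : 0 < δ) (hδ1 : δ < 1) :
    normalBound d T δ ≤ 5 * pslbLog d T δ := by
  have hL := one_le_pslbLog hd hT hδ hδ1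
  have h0 := one_le_mul_div hd hT hδ hδ1
  have h1 : 8 * (pslbDraws T δ : ℝ) * d * T / δ ≤ 2 ^ 12 * (d * T / δ) ^ 2 := by
    have h2 := pslbDraws_le hT hδ hδ1
    have h3 := div_le_mul_div hd hT hδ hδ1
    have e : 8 * (pslbDraws T δ : ℝ) * d * T / δ = 8 * pslbDraws T δ * (d * T / δ) := by ring
    rw [e]
    nlinarith
  have h2 := Real.log_le_log (by linarith [one_le_normalBound_arg hd hT hδ hδ1]) h1
  rw [Real.log_mul (by norm_num) (by positivity), Real.log_pow, Real.log_pow] at h2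
  have h3 := Real.log_two_lt_d9
  have hLdef : pslbLog d T δ = 1 + Real.log (d * T / δ) := rfl
  rw [normalBound, Real.sqrt_le_left (by linarith)]
  push_cast at h2
  nlinarith

lemma exp_normalBound_eq (hd : 1 ≤ d) (hT : 1 ≤ T) (hδ : 0 < δ) (hδ1 : δ < 1) :
    pslbDraws T δ * d * (2 * Real.exp (-(normalBound d T δ ^ 2 / 2))) = δ / (4 * T) := by
  have h0 := one_le_normalBound_arg hd hT hδ hδ1
  have hd' : (d : ℝ) ≠ 0 := by exact_mod_cast (by omega : d ≠ 0)
  have hT' : (T : ℝ) ≠ 0 := by exact_mod_cast (by omega : T ≠ 0)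
  have hM : (pslbDraws T δ : ℝ) ≠ 0 := by exact_mod_cast (pslbDraws_pos hT hδ hδ1).ne'
  rw [normalBound, Real.sq_sqrt (mul_nonneg two_pos.le (Real.log_nonneg h0)),
    mul_div_cancel_left₀ _ two_ne_zero, Real.exp_neg, Real.exp_log (by linarith)]
  field_simp
  norm_num

/-- The slack in the anti-concentration bound leaves room for a noise level above `B`. -/
lemma exists_noise_level (B : ℝ≥0) (hd : 1 ≤ d) (hT : 1 ≤ T) (hδ : 0 < δ) (hδ1 : δ < 1) {ν : ℝ}
    (hν : pslbRadius B d T (δ / 4) ≤ ν) :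
    ∃ σ : ℝ, 0 < σ ∧ B ≤ σ ∧
      √(d : ℝ) + √(σ ^ 2 * (d * Real.log (1 + T) + 2 * Real.log (1 / (δ / (4 * T))))) ≤
        3 / 2 * ν := by
  have hT' : (1 : ℝ) ≤ T := by exact_mod_cast hT
  have hd' : (1 : ℝ) ≤ d := by exact_mod_cast hd
  have e : (T : ℝ) / (δ / 4) = 1 / (δ / (4 * T)) := by field_simp
  rw [pslbRadius, e] at hν
  set X := d * Real.log (1 + T) + 2 * Real.log (1 / (δ / (4 * T))) with hX
  have hX0 : 0 < X := by
    have h1 : 0 < Real.log (1 + T) := Real.log_pos (by linarith)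
    have h2 : 0 ≤ Real.log (1 / (δ / (4 * T))) := by
      refine Real.log_nonneg ?_
      rw [← e, le_div_iff₀ (by positivity)]; linarith
    positivity
  have hr : 0 < √X := Real.sqrt_pos.2 hX0
  have hsd : 0 < √(d : ℝ) := Real.sqrt_pos.2 (by linarith)
  have hB : (0 : ℝ) ≤ B := B.2
  -- The increment contributes exactly `√d / 2` to the radius, paid for by the factor `3 / 2`, and
  -- keeps `σ` positive when `B = 0`.
  refine ⟨B + √d / (2 * √X), by positivity, by simp; positivity, ?_⟩
  rw [Real.sqrt_mul (sq_nonneg _), Real.sqrt_sq (by positivity)]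
  have h3 : (B + √(d : ℝ) / (2 * √X)) * √X = B * √X + √d / 2 := by field_simp
  rw [h3]
  have : 0 ≤ B * √X := by positivity
  linarith

/-- Here `d ≤ T` gives `d ^ 2 ≤ √(d ^ 3 * T)`, which absorbs the logarithmic part of `G` into the
leading term; hence `154 = 14 + 140`. -/
lemma regret_bound_of_le {d T L m r ν κ R G : ℝ} {p : ℕ} (hd : 1 ≤ d) (hdT : d ≤ T) (hL : 1 ≤ L)
    (hm : 0 ≤ m) (hr0 : 0 ≤ r) (hr : r ≤ 5 * L) (hν0 : 0 ≤ ν) (hν : ν ≤ κ * √d * L ^ p)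
    {ℓ : ℝ} (hℓ0 : 0 ≤ ℓ) (hℓ : ℓ ≤ L) (hG : G ≤ 2 * m + 5 * L)
    (hR : R ≤ ν * (3 / 2 + √d * r) * (√(T * (4 * d * ℓ)) + G * (4 * d * ℓ))) :
    R ≤ (154 * |κ| + 2) * √(d ^ 3 * T * L ^ (2 * p + 6)) +
      (56 * |κ| + 1) * (d ^ 2 * m * L ^ (2 * p + 6)) + 1 * L ^ (2 * p + 6) := by
  have hT : 0 ≤ T := by linarith
  set k := |κ| with hk
  have hk0 : 0 ≤ k := abs_nonneg _
  have hs1 : 1 ≤ √d := Real.one_le_sqrt.2 hd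
  have hss : √d * √d = d := Real.mul_self_sqrt (by linarith)
  have hν' : ν ≤ k * √d * L ^ p := hν.trans (by gcongr; exact le_abs_self κ)
  have h1 : 3 / 2 + √d * r ≤ 7 * (√d * L) := by
    have h2 : √d * r ≤ √d * (5 * L) := by gcongr
    nlinarith
  have h2 : ν * (3 / 2 + √d * r) ≤ 7 * k * d * L ^ (p + 1) := by
    calc _ ≤ k * √d * L ^ p * (7 * (√d * L)) := by gcongr
      _ = 7 * k * (√d * √d) * L ^ (p + 1) := by ring
      _ = _ := by rw [hss]
  have h3 : √(T * (4 * d * ℓ)) ≤ 2 * √(d * T) * L := by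
    have h : ℓ ≤ L ^ 2 := by nlinarith
    have h4 : d * T * ℓ ≤ d * T * L ^ 2 := by gcongr
    refine Real.sqrt_le_iff.2 ⟨by positivity, ?_⟩
    rw [mul_pow, mul_pow, Real.sq_sqrt (by positivity)]
    linarith
  have h4 : G * (4 * d * ℓ) ≤ (2 * m + 5 * L) * (4 * d * L) := by gcongr
  have h5 : R ≤ 7 * k * d * L ^ (p + 1) *
      (2 * √(d * T) * L + (2 * m + 5 * L) * (4 * d * L)) := by
    refine hR.trans ?_
    calc _ ≤ ν * (3 / 2 + √d * r) * (2 * √(d * T) * L + (2 * m + 5 * L) * (4 * d * L)) := by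
          gcongr
      _ ≤ _ := by gcongr
  set Q := √(d ^ 3 * T) with hQ
  have hQ1 : d * √(d * T) = Q := by
    have h : √(d ^ 2 * (d * T)) = √(d ^ 2) * √(d * T) := Real.sqrt_mul (sq_nonneg d) _
    rw [hQ, show d ^ 3 * T = d ^ 2 * (d * T) by ring, h, Real.sqrt_sq (by linarith)]
  have hQ2 : d ^ 2 ≤ Q := by
    rw [hQ]
    refine Real.le_sqrt_of_sq_le ?_
    calc (d ^ 2) ^ 2 = d ^ 3 * d := by ring
      _ ≤ _ := by gcongr
  have hQL : √(d ^ 3 * T * L ^ (2 * p + 6)) = Q * L ^ (p + 3) := by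
    rw [Real.sqrt_mul (by positivity), show L ^ (2 * p + 6) = (L ^ (p + 3)) ^ 2 by ring,
      Real.sqrt_sq (by positivity)]
  rw [hQL]
  have hp1 : L ^ (p + 2) ≤ L ^ (p + 3) := pow_le_pow_right₀ hL (by omega)
  have hp2 : L ^ (p + 2) ≤ L ^ (2 * p + 6) := pow_le_pow_right₀ hL (by omega)
  have e : 7 * k * d * L ^ (p + 1) * (2 * √(d * T) * L + (2 * m + 5 * L) * (4 * d * L)) =
      14 * k * (d * √(d * T)) * L ^ (p + 2) + 56 * k * (d ^ 2 * m * L ^ (p + 2)) +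
        140 * k * d ^ 2 * L ^ (p + 3) := by ring
  rw [e, hQ1] at h5
  have hQ0 : 0 ≤ Q := Real.sqrt_nonneg _
  have a1 : 14 * k * Q * L ^ (p + 2) ≤ 14 * k * Q * L ^ (p + 3) := by gcongr
  have a2 : 56 * k * (d ^ 2 * m * L ^ (p + 2)) ≤ 56 * k * (d ^ 2 * m * L ^ (2 * p + 6)) := by gcongr
  have a3 : 140 * k * d ^ 2 * L ^ (p + 3) ≤ 140 * k * Q * L ^ (p + 3) := by gcongr
  have a4 : 0 ≤ Q * L ^ (p + 3) := by positivity
  have a5 : 0 ≤ d ^ 2 * m * L ^ (2 * p + 6) := by positivity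
  have a6 : 0 ≤ L ^ (2 * p + 6) := by positivity
  linarith

/-- When `T ≤ d`, the trivial bound already satisfies `T * √d ≤ √(d ^ 3 * T)`; the summand 2 in the
constant serves this case. -/
lemma regret_bound_of_lt {d T L m κ R : ℝ} {q : ℕ} (hT : 1 ≤ T) (hTd : T ≤ d) (hL : 1 ≤ L)
    (hm : 0 ≤ m) (hR : R ≤ T * (2 * √d)) :
    R ≤ (154 * |κ| + 2) * √(d ^ 3 * T * L ^ q) +
      (56 * |κ| + 1) * (d ^ 2 * m * L ^ q) + 1 * L ^ q := by
  have hLq : 1 ≤ L ^ q := one_le_pow₀ hL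
  have hd : 1 ≤ d := hT.trans hTd
  have h1 : T * √d ≤ √(d ^ 3 * T * L ^ q) := by
    refine Real.le_sqrt_of_sq_le ?_
    rw [mul_pow, Real.sq_sqrt (by linarith)]
    calc T ^ 2 * d = T * d * T := by ring
      _ ≤ d * d * T := by gcongr
      _ ≤ d ^ 3 * T := by
        have : d * d ≤ d ^ 3 := by nlinarith [mul_pos (by linarith : (0:ℝ) < d) (by linarith : (0:ℝ) < d)]
        gcongr
      _ ≤ d ^ 3 * T * L ^ q := le_mul_of_one_le_right (by positivity) hLq
  have h2 : 0 ≤ |κ| * √(d ^ 3 * T * L ^ q) := by positivity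
  have h3 : 0 ≤ (56 * |κ| + 1) * (d ^ 2 * m * L ^ q) := by positivity
  linarith

end Parameters

/-! ### Summing the regret over the good event -/

namespace DelayedLinearBandit

open Matrix
open scoped ENNReal

variable {d T : ℕ} {B : ℝ≥0} {f : PMF ℕ} {Ω : Type*} [mΩ : MeasurableSpace Ω]
  [StandardBorelSpace Ω] {P : Measure Ω} [IsProbabilityMeasure P]
  (𝓑 : DelayedLinearBandit d T B f P)
  {M : ℕ} {ν u : ℝ} {ζ : ℕ → Ω → Fin M → EuclideanSpace ℝ (Fin d)}

lemma regret_eq (ω : Ω) : 𝓑.regret ω = ∑ t ∈ Finset.range T,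
    (supportFun (𝓑.D t ω) 𝓑.θ - inner ℝ (𝓑.x t ω) 𝓑.θ) := rfl

lemma regret_le_trivial (ω : Ω) : 𝓑.regret ω ≤ T * (2 * √(d : ℝ)) := by
  rw [regret_eq]
  calc _ ≤ ∑ _t ∈ Finset.range T, 2 * √(d : ℝ) := by
        refine Finset.sum_le_sum fun t ht => ?_
        have ht' := Finset.mem_range.1 ht
        have hb : ∀ a ∈ 𝓑.D t ω, |inner ℝ a 𝓑.θ| ≤ √(d : ℝ) := fun a ha =>
          (abs_real_inner_le_norm a 𝓑.θ).trans ((mul_le_of_le_one_left (norm_nonneg _)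
            (𝓑.norm_le_one t ht' ω a ha)).trans 𝓑.norm_θ_le)
        have hx := 𝓑.x_mem t ht' ω
        have h1 : supportFun (𝓑.D t ω) 𝓑.θ ≤ √(d : ℝ) :=
          supportFun_le ⟨_, hx⟩ fun a ha => (le_abs_self _).trans (hb a ha)
        have h2 := neg_le_of_abs_le (hb _ hx)
        linarith
    _ = _ := by simp

lemma regret_le_of_good (hζ : 𝓑.IsDelayedPSLB M 1 1 ν u ζ) (hν : 0 ≤ ν)
    (hu : ∀ t < T, ∀ ω, ∀ a ∈ 𝓑.D t ω, inner ℝ a 𝓑.θ ≤ u) {K : ℝ} (hK : √d + √K ≤ 3 / 2 * ν)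
    {r G : ℝ} (hr : 0 ≤ r) (hG : 1 ≤ G) {ω : Ω}
    (hconf : ∀ t < T, invQuad (𝓑.unitPrecision t ω) (𝓑.noiseSum t ω) ≤ K)
    (hopt : ∀ t < T, ∃ m, supportFun (𝓑.D t ω) 𝓑.θ ≤
      supportFun (𝓑.D t ω) (𝓑.posteriorDraw 1 1 ν t ω (ζ t ω m)))
    (hnorm : ∀ t < T, ∀ m i, |ζ t ω m i| ≤ r)
    (hcard : ∀ t < T, ((Finset.range t \ 𝓑.observed t ω).card : ℝ) ≤ G) :
    𝓑.regret ω ≤ ν * (3 / 2 + √d * r) *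
      (√(T * (4 * d * Real.log (1 + T))) + G * (4 * d * Real.log (1 + T))) := by
  have h := sum_sqrt_invQuad_delayed_le (fun s => (𝓑.x s ω).ofLp) T (fun t ht => by
      rw [← real_inner_eq_dotProduct, real_inner_self_eq_norm_sq]
      exact pow_le_one₀ (norm_nonneg _) (𝓑.norm_le_one t ht ω _ (𝓑.x_mem t ht ω)))
    (fun t => 𝓑.observed t ω) (fun t => 𝓑.observed_subset_range t ω) (𝓑.monotone_observed ω)
    hG hcard
  rw [Fintype.card_fin] at h
  rw [regret_eq]
  calc _ ≤ ∑ t ∈ Finset.range T, ν * (3 / 2 + √d * r) *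
        √(invQuad (𝓑.unitPrecision t ω) (𝓑.x t ω).ofLp) := by
        refine Finset.sum_le_sum fun t ht => ?_
        have ht' := Finset.mem_range.1 ht
        exact 𝓑.supportFun_sub_inner_le hζ hν ht' (hu t ht') hK hr (hconf t ht') (hopt t ht')
          (hnorm t ht')
    _ = ν * (3 / 2 + √d * r) * ∑ t ∈ Finset.range T,
        √(invQuad (𝓑.unitPrecision t ω) (𝓑.x t ω).ofLp) := by rw [Finset.mul_sum]
    _ ≤ _ := mul_le_mul_of_nonneg_left h (by positivity)

/-- The high-probability regret bound in terms of the parameters of the algorithm. -/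
lemma measure_compl_regret_le_le {δ : ℝ} (hd : 1 ≤ d) (hT : 1 ≤ T) (hδ : 0 < δ) (hδ1 : δ < 1)
    (hf : Integrable (fun n : ℕ => (n : ℝ)) f.toMeasure)
    {ζ : ℕ → Ω → Fin (pslbDraws T δ) → EuclideanSpace ℝ (Fin d)}
    (hζ : 𝓑.IsDelayedPSLB (pslbDraws T δ) 1 1 ν u ζ) (hν : pslbRadius B d T (δ / 4) ≤ ν)
    (hν0 : 0 ≤ ν) (hu : ∀ t < T, ∀ ω, ∀ a ∈ 𝓑.D t ω, inner ℝ a 𝓑.θ ≤ u) :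
    P {ω | 𝓑.regret ω ≤ ν * (3 / 2 + √d * normalBound d T δ) *
      (√(T * (4 * d * Real.log (1 + T))) +
        (1 + 2 * (meanDelay f + Real.log (1 / (δ / (4 * T))))) *
          (4 * d * Real.log (1 + T)))}ᶜ ≤ ENNReal.ofReal δ := by
  have hT' : (1 : ℝ) ≤ T := by exact_mod_cast hT
  obtain ⟨σ, hσ, hBσ, hK⟩ := exists_noise_level B hd hT hδ hδ1 hν
  -- Four bad events in each of `T` rounds share `δ`.
  set ε := δ / (4 * T) with hε
  have hε0 : 0 < ε := by positivity
  set K := σ ^ 2 * (d * Real.log (1 + T) + 2 * Real.log (1 / ε)) with hKdef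
  set A₁ : ℕ → Set Ω := fun t => {ω | K < invQuad (𝓑.unitPrecision t ω) (𝓑.noiseSum t ω)}
  set A₂ : ℕ → Set Ω := fun t => {ω | invQuad (𝓑.unitPrecision t ω) (𝓑.noiseSum t ω) ≤ K ∧
      ∀ m, supportFun (𝓑.D t ω) (𝓑.posteriorDraw 1 1 ν t ω (ζ t ω m)) <
        supportFun (𝓑.D t ω) 𝓑.θ}
  set A₃ : ℕ → Set Ω := fun t => {ω | ∃ m i, normalBound d T δ < |ζ t ω m i|}
  set A₄ : ℕ → Set Ω := fun t => {ω | 2 * (meanDelay f + Real.log (1 / ε)) <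
      ((Finset.range t \ 𝓑.observed t ω).card : ℝ)}
  have hbad : ∀ t ∈ Finset.range T, P (A₁ t ∪ A₂ t ∪ A₃ t ∪ A₄ t) ≤ ENNReal.ofReal (4 * ε) := by
    intro t ht
    have ht' := Finset.mem_range.1 ht
    have h1 : P (A₁ t) ≤ ENNReal.ofReal ε := 𝓑.measure_invQuad_noiseSum_gt_le ht' hσ hBσ hε0
    have h2 : P (A₂ t) ≤ ENNReal.ofReal ε :=
      (𝓑.measure_forall_supportFun_lt_le hζ hν0 ht' hK).trans
        (ENNReal.ofReal_le_ofReal (pow_pslbDraws_le hT hδ))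
    have h3 : P (A₃ t) ≤ ENNReal.ofReal ε :=
      (𝓑.measure_exists_abs_apply_gt_le hζ ht'
        (r := normalBound d T δ) (Real.sqrt_nonneg _)).trans_eq
        (by rw [exp_normalBound_eq hd hT hδ hδ1])
    have h4 : P (A₄ t) ≤ ENNReal.ofReal ε := 𝓑.measure_card_unobserved_gt_le hf ht' hε0
    calc _ ≤ P (A₁ t) + P (A₂ t) + P (A₃ t) + P (A₄ t) :=
          (measure_union_le _ _).trans (add_le_add_left ((measure_union_le _ _).trans
            (add_le_add_left (measure_union_le _ _) _)) _)
      _ ≤ ENNReal.ofReal ε + ENNReal.ofReal ε + ENNReal.ofReal ε + ENNReal.ofReal ε := by gcongr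
      _ = _ := by
        rw [← ENNReal.ofReal_add hε0.le hε0.le, ← ENNReal.ofReal_add (by positivity) hε0.le,
          ← ENNReal.ofReal_add (by positivity) hε0.le]
        congr 1; ring
  have hunion : P (⋃ t ∈ Finset.range T, (A₁ t ∪ A₂ t ∪ A₃ t ∪ A₄ t)) ≤ ENNReal.ofReal δ := by
    refine (measure_biUnion_finset_le _ _).trans ((Finset.sum_le_sum hbad).trans_eq ?_)
    rw [Finset.sum_const, Finset.card_range, nsmul_eq_mul, ← ENNReal.ofReal_natCast,
      ← ENNReal.ofReal_mul (by positivity)]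
    congr 1
    rw [hε]; field_simp
  refine (measure_mono ?_).trans hunion
  rw [Set.compl_subset_comm]
  intro ω hω
  simp only [Set.mem_compl_iff, Set.mem_iUnion, Finset.mem_range, exists_prop, not_exists,
    not_and] at hω
  have g1 : ∀ t < T, invQuad (𝓑.unitPrecision t ω) (𝓑.noiseSum t ω) ≤ K := fun t ht => by
    by_contra! h
    exact hω t ht (Or.inl (Or.inl (Or.inl h)))
  have hlog : 0 ≤ Real.log (1 / ε) := by
    refine Real.log_nonneg ?_
    rw [hε, one_div_div, le_div_iff₀ hδ]; linarith
  have hmean : 0 ≤ meanDelay f := integral_nonneg fun _ => Nat.cast_nonneg _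
  refine 𝓑.regret_le_of_good hζ hν0 hu hK (Real.sqrt_nonneg _) (by linarith) g1 (fun t ht => ?_)
    (fun t ht m i => ?_) (fun t ht => ?_)
  · by_contra! h
    exact hω t ht (Or.inl (Or.inl (Or.inr ⟨g1 t ht, h⟩)))
  · by_contra! h
    exact hω t ht (Or.inl (Or.inr ⟨m, i, h⟩))
  · by_contra! h
    refine hω t ht (Or.inr ?_)
    rw [Set.mem_ofPred_eq]
    linarith

end DelayedLinearBandit

end

theorem corollary3 (p : ℕ) :
    ∃ q : ℕ, ∀ (B : ℝ≥0) (κ : ℝ), ∃ c c' c'' : ℝ, 0 < c ∧ 0 < c' ∧ 0 < c'' ∧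
      ∀ (d T : ℕ), 1 ≤ d → 1 ≤ T → ∀ δ : ℝ, 0 < δ → δ < 1 →
      ∀ (f : PMF ℕ) (v b : ℝ), IsSubexponentialDelay f v b →
      ∀ (Ω : Type*) [MeasurableSpace Ω] [StandardBorelSpace Ω]
        (P : Measure Ω) [IsProbabilityMeasure P] (𝓑 : DelayedLinearBandit d T B f P) (u : ℝ),
        (∀ t < T, ∀ ω, ∀ a ∈ 𝓑.D t ω, inner ℝ a 𝓑.θ ≤ u) →
      ∀ (ν : ℝ), pslbRadius B d T (δ / 4) ≤ ν → ν ≤ κ * √(d : ℝ) * pslbLog d T δ ^ p →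
      ∀ (ζ : ℕ → Ω → Fin (pslbDraws T δ) → EuclideanSpace ℝ (Fin d)),
        𝓑.IsDelayedPSLB (pslbDraws T δ) 1 1 ν u ζ →
        1 - δ ≤ P.real {ω | 𝓑.regret ω ≤
          c * √((d : ℝ) ^ 3 * T * pslbLog d T δ ^ q)
            + c' * ((d : ℝ) ^ 2 * meanDelay f * pslbLog d T δ ^ q)
            + c'' * pslbLog d T δ ^ q} := by
  -- The largest power of the logarithm outside the root is `p + 3`: `p` from `ν`, one from the
  -- normal vectors, two from `G` times the potential. Under the root it doubles.
  refine ⟨2 * p + 6, fun B κ => ⟨154 * |κ| + 2, 56 * |κ| + 1, 1, by positivity, by positivity,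
    one_pos, ?_⟩⟩
  intro d T hd hT δ hδ hδ1 f v b hf Ω _ _ P _ 𝓑 u hu ν hν hνκ ζ hζ
  have hν0 : 0 ≤ ν := le_trans (by rw [pslbRadius]; positivity) hν
  have hL := one_le_pslbLog hd hT hδ hδ1
  have hmean : 0 ≤ meanDelay f := integral_nonneg fun _ => Nat.cast_nonneg _
  have hd' : (1 : ℝ) ≤ d := by exact_mod_cast hd
  have hT' : (1 : ℝ) ≤ T := by exact_mod_cast hT
  have hbad := 𝓑.measure_compl_regret_le_le hd hT hδ hδ1 hf.2.2.1 hζ hν hν0 hu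
  -- Subadditivity is used because the regret event is not known to be measurable.
  have key : ∀ S S' : Set Ω, P Sᶜ ≤ ENNReal.ofReal δ → S ⊆ S' → 1 - δ ≤ P.real S' := by
    intro S S' hS hSS'
    have h1 : (1 : ENNReal) ≤ P S + P Sᶜ := by
      have := measure_union_le (μ := P) S Sᶜ
      rwa [Set.union_compl_self, measure_univ] at this
    have h2 : (1 : ENNReal) ≤ P S' + ENNReal.ofReal δ :=
      h1.trans (add_le_add (measure_mono hSS') hS)
    rw [← ofReal_measureReal, ← ENNReal.ofReal_add measureReal_nonneg hδ.le,
      ← ENNReal.ofReal_one, ENNReal.ofReal_le_ofReal_iff (by positivity)] at h2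
    linarith
  refine key _ _ hbad fun ω hω => ?_
  rw [Set.mem_ofPred_eq] at hω ⊢
  rcases le_total (d : ℝ) T with hdT | hTd
  · refine regret_bound_of_le hd' hdT hL hmean (Real.sqrt_nonneg _) (normalBound_le hd hT hδ hδ1)
      hν0 hνκ (Real.log_nonneg (by linarith)) (log_one_add_le hd hT hδ hδ1) ?_ hω
    have := log_four_mul_div_le hd hT hδ hδ1
    rw [one_div_div]
    linarith
  · exact regret_bound_of_lt hT' hTd hL hmean (𝓑.regret_le_trivial ω)
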